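/- **Conventions.** Graphs are undirected and may have loops; $\Gamma(v)$ is the set of vertices adjacent to $v$ (it contains $v$ if there is a loop at $v$), $\Gamma(S)=\bigcup_{v\in S}\Gamma(v)$, and a graph is $D$-regular if $|\Gamma(v)|=D$ for all $v$. A $D$-regular graph is a $(K,\varepsilon)$-lossless expander if $|\Gamma(S)|\ge(1-\varepsilon)D|S|$ for every vertex set $S$ with $|S|\le K$. For a prime $q$ and integers $n,s$ with $s+1<n<q$, the KT graph is the bipartite graph with left vertices $\mathbb F_q^n$ (read as polynomials $f$ over $\mathbb F_q$ of degree less than $n$) and right vertices $\mathbb F_q^{s+2}$, in which $f$ is joined to $(y,f(y),f'(y),\dots,f^{(s)}(y))$ for each $y\in\mathbb F_q$ (iterated formal derivatives). Its bipartite half $G_{q,n,s}$ has vertex set $\mathbb F_q^n$, and $f,g$ are adjacent iff they have a common right neighbour (so there is a loop at each $f$). Running times are those of a random access machine with logarithmic cost. **Theorem.** There are a function $n\mapsto q(n)$ and an absolute constant $c$ such that, for every $n\ge1$, $q(n)$ is a prime with $n<q(n)\le c\,(\log_2 N)^{c}$, where $N=N_n:=q(n)^n$, and $q(n)$ can be computed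 from $n$ in time $cn^{c}$. For every fixed real $0<\delta<0.99$ there are integers $s(n)\ge0$ and a real sequence $o(1)=o_\delta(n)\to0$ such that for all sufficiently large $n$ (hence for infinitely many $N=N_n$, the sequence $(N_n)$ not depending on $\delta$), with $q=q(n)$ and $s=s(n)$, one has $s+1<n$ and the graph $G=G_{q,n,s}$, which has $N$ vertices, satisfies: 1. $G$ is $D$-regular for some $D$ with $N^{1-1.01\delta}\le D\le N^{1-1.01\delta+o(1)}$, and it is a $(K,0.01)$-lossless expander with $K=\min\bigl(N^{\delta},N^{1-1.01\delta-o(1)}\bigr)$. 2. $G$ is not bipartite, even when its loops are disregarded. 3. $G$ is explicit: there is a function $\Gamma:\mathbb F_q^n\times(\mathbb F_q\times\mathbb F_q^{\,n-(s+1)})\to\mathbb F_q^n\cup\{\bot\}$ such that $\Gamma(f,\cdot)$ takes only neighbours of $f$ and $\bot$ as values, takes each neighbour of $f$ exactly once, and is computed, from $q,n,s,f$ and the index, in time $c(n+q)^c$ by one program that does not depend on $n$ or $\delta$. Moreover one fixed program computes $s(n)$ from $n,a,b$, in time polynomial in $n$ and the bit lengths of $a,b$, whenever $\delta=a/b$ with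 integers $a\ge 0$, $b>0$. 4. The multiplicative group $\mathbb F_q^{*}$ acts on $\mathbb F_q^n\setminus\{0\}$ by scaling; this action is free, and it preserves the adjacency relation of the graph obtained from $G$ by deleting the vertex $0$. -/

import Mathlib

open Filter Topology Polynomial

/-! ### Undirected graphs, loops allowed, and vertex expansion -/

/-- An undirected graph on the vertex set `V`; a vertex may be adjacent to itself. -/
structure LoopGraph (V : Type*) where
  Adj : V → V → Prop
  symm : ∀ u v, Adj u v → Adj v u

namespace LoopGraph

variable {V : Type*}

/-- The neighbourhood `Γ(v)`; it contains `v` exactly when there is a loop at `v`. -/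
def nbrs (G : LoopGraph V) (v : V) : Set V := {w | G.Adj v w}

/-- The neighbourhood `Γ(S) = ⋃_{v ∈ S} Γ(v)` of a set of vertices. -/
def nbrsOf (G : LoopGraph V) (S : Finset V) : Set V := {w | ∃ v ∈ S, G.Adj v w}

/-- Every vertex has exactly `D` neighbours. -/
def IsRegular (G : LoopGraph V) (D : ℕ) : Prop :=
  ∀ v, (G.nbrs v).Finite ∧ (G.nbrs v).ncard = D

/-- A `D`-regular graph in which `|Γ(S)| ≥ (1 - ε) D |S|` for all vertex sets `S` with
`|S| ≤ K`. -/
def IsLosslessExpander (G : LoopGraph V) (D : ℕ) (K ε : ℝ) : Prop :=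
  G.IsRegular D ∧
    ∀ S : Finset V, (S.card : ℝ) ≤ K → (1 - ε) * D * S.card ≤ ((G.nbrsOf S).ncard : ℝ)

/-- The vertices split into two classes such that every edge other than a loop joins the two
classes. Loops are disregarded, so that the negation is not forced by a loop. -/
def IsBipartite (G : LoopGraph V) : Prop :=
  ∃ c : V → Bool, ∀ u v, u ≠ v → G.Adj u v → c u ≠ c v

/-- The graph with the vertex `v` deleted. -/
def deleteVertex (G : LoopGraph V) (v : V) : LoopGraph {u : V // u ≠ v} where
  Adj u w := G.Adj u.1 w.1
  symm u w h := G.symm u.1 w.1 h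

/-- The edge set is invariant under the group action. -/
def IsInvariant (G : LoopGraph V) (A : Type*) [Group A] [MulAction A V] : Prop :=
  ∀ (a : A) (u v : V), G.Adj u v → G.Adj (a • u) (a • v)

/-- `Γ` lists the neighbours of each vertex, each of them exactly once; `Γ v i = none` (written
`⊥` informally) means that the index `i` is not used at `v`. -/
def IsNeighborFunction {I : Type*} (G : LoopGraph V) (Γ : V → I → Option V) : Prop :=
  (∀ v i w, Γ v i = some w → G.Adj v w) ∧
    ∀ v w, G.Adj v w → ∃! i, Γ v i = some w

end LoopGraph

/-- A group action is free: only the identity fixes a point. -/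
def IsFreeAction (A X : Type*) [Group A] [MulAction A X] : Prop :=
  ∀ (a : A) (x : X), a • x = x → a = 1

/-! ### Bipartite graphs, the bipartite half and the KT graph -/

/-- A bipartite graph with left vertices `L` and right vertices `R`. -/
structure BipGraph (L R : Type*) where
  Adj : L → R → Prop

/-- The bipartite half `G²[L]`: the vertices are the left vertices, and `v`, `w` are adjacent iff
they have a common right neighbour, i.e. iff `w ∈ Γ_R(Γ_L(v))`. -/
def BipGraph.half {L R : Type*} (G : BipGraph L R) : LoopGraph L where
  Adj v w := ∃ r, G.Adj v r ∧ G.Adj w r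
  symm := fun _ _ ⟨r, hv, hw⟩ => ⟨r, hw, hv⟩

/-- The vector `f` read as the polynomial `∑ f_i X^i` of degree less than `n`. -/
noncomputable def vecPoly {F : Type*} [CommRing F] {n : ℕ} (f : Fin n → F) : F[X] :=
  ∑ i : Fin n, C (f i) * X ^ (i : ℕ)

/-- The `y`-th neighbour `(y, f(y), f'(y), …, f^{(s)}(y))` of the left vertex `f`, with iterated
formal derivatives. -/
noncomputable def ktNbr {F : Type*} [CommRing F] {n : ℕ} (s : ℕ) (f : Fin n → F) (y : F) :
    Fin (s + 2) → F :=
  Fin.cons y (fun j : Fin (s + 1) => (derivative^[(j : ℕ)] (vecPoly f)).eval y)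

/-- The KT graph, with left vertices `F^n`, right vertices `F^(s+2)`. -/
def ktGraph (F : Type*) [CommRing F] (n s : ℕ) : BipGraph (Fin n → F) (Fin (s + 2) → F) where
  Adj f z := ∃ y : F, z = ktNbr s f y

/-- The bipartite half of the KT graph. -/
def ktHalf (F : Type*) [CommRing F] (n s : ℕ) : LoopGraph (Fin n → F) := (ktGraph F n s).half

/-! ### Running time: random access machines with logarithmic cost -/

/-- Registers, addressed directly, and memory cells, addressed through registers. -/
structure RamState where
  reg : ℕ → ℕ
  mem : ℕ → ℕ

/-- Arithmetic operations on natural numbers (truncated subtraction, division rounding down). -/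
inductive RamOp
  | add | sub | mul | div | mod

def RamOp.eval : RamOp → ℕ → ℕ → ℕ
  | .add, a, b => a + b
  | .sub, a, b => a - b
  | .mul, a, b => a * b
  | .div, a, b => a / b
  | .mod, a, b => a % b

/-- Structured programs of a random access machine. -/
inductive RamProg
  | skip
  /-- `reg d := c` -/
  | const (d c : ℕ)
  /-- `reg d := reg a ∘ reg b` -/
  | arith (o : RamOp) (d a b : ℕ)
  /-- `reg d := mem (reg a)` -/
  | load (d a : ℕ)
  /-- `mem (reg a) := reg b` -/
  | store (a b : ℕ)
  | seq (P Q : RamProg)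
  /-- if `reg a ≠ 0` then `P` else `Q` -/
  | branch (a : ℕ) (P Q : RamProg)
  /-- while `reg a ≠ 0` do `P` -/
  | loop (a : ℕ) (P : RamProg)

/-- `P.Runs σ τ t`: started in the state `σ`, the program `P` halts in the state `τ` at total cost
`t`. Every elementary step costs `1` plus the bit lengths of all numbers that it handles (operands,
results, indirect addresses). -/
inductive RamProg.Runs : RamProg → RamState → RamState → ℕ → Prop
  | skip (σ : RamState) : Runs .skip σ σ 1
  | const (σ : RamState) (d c : ℕ) :
      Runs (.const d c) σ ⟨Function.update σ.reg d c, σ.mem⟩ (1 + c.size)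
  | arith (σ : RamState) (o : RamOp) (d a b : ℕ) :
      Runs (.arith o d a b) σ
        ⟨Function.update σ.reg d (o.eval (σ.reg a) (σ.reg b)), σ.mem⟩
        (1 + (σ.reg a).size + (σ.reg b).size + (o.eval (σ.reg a) (σ.reg b)).size)
  | load (σ : RamState) (d a : ℕ) :
      Runs (.load d a) σ ⟨Function.update σ.reg d (σ.mem (σ.reg a)), σ.mem⟩
        (1 + (σ.reg a).size + (σ.mem (σ.reg a)).size)
  | store (σ : RamState) (a b : ℕ) :
      Runs (.store a b) σ ⟨σ.reg, Function.update σ.mem (σ.reg a) (σ.reg b)⟩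
        (1 + (σ.reg a).size + (σ.reg b).size)
  | seq {P Q : RamProg} {σ τ υ : RamState} {t u : ℕ} :
      Runs P σ τ t → Runs Q τ υ u → Runs (.seq P Q) σ υ (t + u)
  | branchTrue {P Q : RamProg} {a : ℕ} {σ τ : RamState} {t : ℕ} :
      σ.reg a ≠ 0 → Runs P σ τ t → Runs (.branch a P Q) σ τ (1 + (σ.reg a).size + t)
  | branchFalse {P Q : RamProg} {a : ℕ} {σ τ : RamState} {t : ℕ} :
      σ.reg a = 0 → Runs Q σ τ t → Runs (.branch a P Q) σ τ (1 + t)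
  | loopDone {P : RamProg} {a : ℕ} {σ : RamState} :
      σ.reg a = 0 → Runs (.loop a P) σ σ 1
  | loopStep {P : RamProg} {a : ℕ} {σ τ υ : RamState} {t u : ℕ} :
      σ.reg a ≠ 0 → Runs P σ τ t → Runs (.loop a P) τ υ u →
        Runs (.loop a P) σ υ (1 + (σ.reg a).size + t + u)

/-- Initial state: the input list stands in memory from cell `0` on, its length in register `0`;
everything else is `0`. -/
def RamState.init (input : List ℕ) : RamState where
  reg r := if r = 0 then input.length else 0
  mem i := input.getD i 0

/-- The output list stands in memory from cell `0` on, its length in register `0`. -/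
def RamState.HasOutput (σ : RamState) (output : List ℕ) : Prop :=
  σ.reg 0 = output.length ∧ ∀ i < output.length, σ.mem i = output.getD i 0

/-- On the given input the program halts with the given output at cost at most `T`. -/
def RamProg.ComputesWithin (P : RamProg) (input output : List ℕ) (T : ℕ) : Prop :=
  ∃ (σ : RamState) (t : ℕ), P.Runs (RamState.init input) σ t ∧ t ≤ T ∧ σ.HasOutput output

/-- A vector over `ℤ/qℤ` as the list of its representatives in `{0, …, q - 1}`. -/
def encodeVec {q n : ℕ} (f : Fin n → ZMod q) : List ℕ := List.ofFn fun i => (f i).val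

/-- `⊥` is encoded by `[0]`, a vector `g` by `1` followed by its entries. -/
def encodeOptVec {q n : ℕ} : Option (Fin n → ZMod q) → List ℕ
  | none => [0]
  | some g => 1 :: encodeVec g

/-- The program `P` computes, within cost `T`, a neighbour function
`𝔽_q^n × (𝔽_q × 𝔽_q^(n-(s+1))) → 𝔽_q^n ∪ {⊥}` of the graph `G`. The input is `q`, `n`, `s`, the
vertex `f` and the index `(y, t)`. -/
def ListsNeighbors {q n : ℕ} (P : RamProg) (s : ℕ) (G : LoopGraph (Fin n → ZMod q)) (T : ℕ) :
    Prop :=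
  ∃ Γ : (Fin n → ZMod q) → ZMod q × (Fin (n - (s + 1)) → ZMod q) → Option (Fin n → ZMod q),
    G.IsNeighborFunction Γ ∧
      ∀ (f : Fin n → ZMod q) (y : ZMod q) (t : Fin (n - (s + 1)) → ZMod q),
        P.ComputesWithin ([q, n, s] ++ encodeVec f ++ [y.val] ++ encodeVec t)
          (encodeOptVec (Γ f (y, t))) T

/-!
The bipartite half of the KT graph is a Cayley graph: `f` and `g` are adjacent if and only if
`(X - y)^(s+1)` divides `g - f` for some `y` (`ktHalf_adj_iff`). Hence it is regular, and its degree
lies between `q^(n-s-1)` and `q^(n-s)`.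

*From left to right.* The KT graph itself loses only a factor close to `1`
(`mul_card_le_card_ktNbrs`). For a set `S` of polynomials with `q |S| < h^(s+2)`, some nonzero
`Q(y, z₀, …, z_s)` of degree less than `h` in each variable vanishes on all right neighbours of `S`.
As `(s+2) h n ≤ q`, every `f ∈ S` solves the differential equation `Q(X, f, f', …, f^(s)) = 0`. If
`Q` has least total degree among such equations, its separant, the derivative in the highest
variable `z_j` that occurs, is nonzero on some `f ∈ S`. Where the separant of `f` is nonzero, the
solution is determined by its jet (`eq_of_separant_eval_ne_zero`), so the right neighbour of `f`
there is not shared with another member of `S`. Thus `f` has at least `q - (s+2) h n` right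
neighbours of its own; remove `f` and repeat.

*From right to left.* Right vertices have `q^(n-s-1)` left neighbours each, and two of them share at
most `max(1, q^(n-2(s+1)))`. If `S` obeys both bounds in `K`, Bonferroni's inequality shows that
these overlaps are negligible (`card_ktNbrs_mul_le_ncard_nbrsOf`, `overlap_le`).

*Parameters.* `q` is the least prime above `n^606`, `s + 1 = ⌊1.01 δ n⌋`, `h = ⌊q / (1000 n²)⌋` and
`o(n) = 2 / n`. The factor `1.01` is what makes one exponent serve all `δ`: with
`|S| ≤ q^(δ n)`, the requirement `q |S| < h^(s+2)` asks for `h` slightly above `q^(1/1.01)`, and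
`h ≥ q^(201/202)` holds because `q^(1/202) ≥ n³`.

*Computation.* Running times are proved with a small Hoare calculus (`RamProg.Halts`) that counts
elementary steps under a global bound `B` on all numbers. The prime is found by trial division. A
neighbour of `f` is `f + (X - y)^(s+1) t`; it may arise from several `y`, and is listed for the
least of them, which Horner division detects.
-/

/-! ### First-order Taylor expansion and partial derivatives -/

/-- Taylor expansion to first order in the single variable `j`, modulo an ideal that contains the
increments of all other variables and the square of the increment of `j`. -/
theorem MvPolynomial.aeval_sub_aeval_sub_pderiv_mul_mem {σ R A : Type*} [CommRing R] [CommRing A]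
    [Algebra R A] (I : Ideal A) (j : σ) (a b : σ → A) (h : ∀ i, i ≠ j → b i - a i ∈ I)
    (hj : (b j - a j) ^ 2 ∈ I) (Q : MvPolynomial σ R) :
    aeval b Q - aeval a Q - aeval a (pderiv j Q) * (b j - a j) ∈ I := by
  classical
  induction Q using MvPolynomial.induction_on with
  | C r => simp
  | add P Q hP hQ =>
    have := I.add_mem hP hQ
    simp only [map_add]
    convert this using 1
    ring
  | mul_X P i hP =>
    by_cases hi : i = j
    · subst hi
      have := I.add_mem (I.mul_mem_left (b i) hP) (I.mul_mem_left (aeval a (pderiv i P)) hj)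
      simp only [map_mul, aeval_X, pderiv_mul, pderiv_X_self, map_add, map_one]
      convert this using 1
      ring
    · have := I.add_mem (I.mul_mem_left (b i) hP) (I.mul_mem_left
        (aeval a P + aeval a (pderiv j P) * (b j - a j)) (h i hi))
      simp only [map_mul, aeval_X, pderiv_mul, pderiv_X_of_ne hi, map_add, map_zero]
      convert this using 1
      ring

theorem MvPolynomial.add_single_mem_support_of_mem_support_pderiv {σ R : Type*} [CommSemiring R]
    {Q : MvPolynomial σ R} {j : σ} {m : σ →₀ ℕ} (h : m ∈ (pderiv j Q).support) :
    m + Finsupp.single j 1 ∈ Q.support := by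
  rw [mem_support_iff, coeff_pderiv] at h
  rw [mem_support_iff]
  exact left_ne_zero_of_mul h

theorem MvPolynomial.vars_pderiv_subset {σ R : Type*} [CommSemiring R]
    (Q : MvPolynomial σ R) (j : σ) : (pderiv j Q).vars ⊆ Q.vars := by
  classical
  intro i hi
  rw [mem_vars_iff_mem_support] at hi ⊢
  obtain ⟨d, hd, hid⟩ := hi
  refine ⟨_, add_single_mem_support_of_mem_support_pderiv hd, ?_⟩
  simp only [Finsupp.mem_support_iff, Finsupp.add_apply] at hid ⊢
  omega

theorem MvPolynomial.totalDegree_pderiv_lt {σ R : Type*} [CommSemiring R]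
    {Q : MvPolynomial σ R} {j : σ} (h : pderiv j Q ≠ 0) :
    (pderiv j Q).totalDegree < Q.totalDegree := by
  classical
  obtain ⟨d, hd, hdeg⟩ := Finset.exists_mem_eq_sup (pderiv j Q).support
    (support_nonempty.2 h) (fun m => m.sum fun _ e => e)
  have := le_totalDegree (add_single_mem_support_of_mem_support_pderiv hd)
  rw [Finsupp.sum_add_index' (by simp) (by simp), Finsupp.sum_single_index rfl] at this
  rw [totalDegree, hdeg]
  omega

theorem MvPolynomial.aeval_congr_of_vars {σ R A : Type*} [CommSemiring R] [CommSemiring A]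
    [Algebra R A] {a b : σ → A} (Q : MvPolynomial σ R) (h : ∀ i ∈ Q.vars, a i = b i) :
    aeval a Q = aeval b Q :=
  eval₂Hom_congr' rfl (fun i hi _ => h i hi) rfl

theorem MvPolynomial.natDegree_aeval_le {σ R : Type*} [Fintype σ] [CommRing R]
    {Q : MvPolynomial σ R} {h d : ℕ} (hQ : ∀ m ∈ Q.support, ∀ i, m i ≤ h) {a : σ → R[X]}
    (ha : ∀ i, (a i).natDegree ≤ d) :
    (aeval a Q).natDegree ≤ Fintype.card σ * (h * d) := by
  classical
  rw [Q.as_sum, map_sum]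
  refine Polynomial.natDegree_sum_le_of_forall_le _ _ fun m hm => ?_
  rw [aeval_monomial, Finsupp.prod_fintype _ _ (by simp)]
  refine (Polynomial.natDegree_C_mul_le _ _).trans ?_
  refine (Polynomial.natDegree_prod_le _ _).trans ?_
  rw [← Finset.card_univ, ← smul_eq_mul, ← Finset.sum_const]
  refine Finset.sum_le_sum fun i _ => ?_
  exact Polynomial.natDegree_pow_le.trans (Nat.mul_le_mul (hQ m hm i) (ha i))

/-- Interpolation: a set of fewer than `h ^ d` points in `d`-space is contained in a hypersurface
whose degree in each variable is less than `h`. -/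
theorem MvPolynomial.exists_ne_zero_eval_eq_zero {K σ : Type*} [Field K] [Fintype σ]
    {h : ℕ} (T : Finset (σ → K)) (hT : T.card < h ^ Fintype.card σ) :
    ∃ Q : MvPolynomial σ K, Q ≠ 0 ∧ (∀ m ∈ Q.support, ∀ i, m i < h) ∧
      ∀ z ∈ T, eval z Q = 0 := by
  classical
  let E : (σ → Fin h) → (σ →₀ ℕ) := fun e => Finsupp.equivFunOnFinite.symm fun i => (e i : ℕ)
  have hE : Function.Injective E := by
    intro e e' hee
    funext i
    exact Fin.ext (DFunLike.congr_fun hee i)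
  let Φ : ((σ → Fin h) → K) →ₗ[K] MvPolynomial σ K :=
    ∑ e, (monomial (E e)).comp (LinearMap.proj e)
  have hΦ : ∀ c, Φ c = ∑ e, monomial (E e) (c e) := fun c => by simp [Φ]
  let Ψ : MvPolynomial σ K →ₗ[K] (T → K) := LinearMap.pi fun z => (aeval z.1).toLinearMap
  have hker : LinearMap.ker (Ψ.comp Φ) ≠ ⊥ := by
    apply LinearMap.ker_ne_bot_of_finrank_lt
    simpa using hT
  obtain ⟨c, hc, hc0⟩ := Submodule.exists_mem_ne_zero_of_ne_bot hker
  have hcoeff : ∀ e, coeff (E e) (Φ c) = c e := by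
    intro e
    rw [hΦ, coeff_sum, Finset.sum_eq_single e]
    · simp
    · intro e' _ he'
      rw [coeff_monomial, if_neg fun h => he' (hE h)]
    · simp
  refine ⟨Φ c, ?_, ?_, ?_⟩
  · intro h0
    apply hc0
    funext e
    rw [← hcoeff e, h0]
    simp
  · intro m hm i
    rw [hΦ] at hm
    obtain ⟨e, -, he⟩ := Finset.mem_biUnion.1 (support_sum hm)
    have := support_monomial_subset he
    rw [Finset.mem_singleton] at this
    subst this
    exact (e i).2
  · intro z hz
    have := congrFun (LinearMap.mem_ker.1 hc) ⟨z, hz⟩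
    simpa [Ψ, aeval_eq_eval] using this

/-! ### Polynomials, jets and divisibility by powers of a linear factor -/

section VecPoly

variable {F : Type*} [CommRing F] {n : ℕ}

theorem coeff_vecPoly (f : Fin n → F) (k : ℕ) :
    (vecPoly f).coeff k = if h : k < n then f ⟨k, h⟩ else 0 := by
  simp only [vecPoly, finsetSum_coeff, coeff_C_mul, coeff_X_pow]
  split_ifs with h
  · rw [Finset.sum_eq_single ⟨k, h⟩]
    · simp
    · intro i _ hi
      rw [if_neg (fun hk => hi (Fin.ext hk.symm)), mul_zero]
    · simp
  · refine Finset.sum_eq_zero fun i _ => ?_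
    rw [if_neg (by have := i.2; omega), mul_zero]

theorem coeff_vecPoly_fin (f : Fin n → F) (i : Fin n) : (vecPoly f).coeff i = f i := by
  simp [coeff_vecPoly]

theorem degree_vecPoly_lt (f : Fin n → F) : (vecPoly f).degree < n := by
  rw [degree_lt_iff_coeff_zero]
  intro k hk
  rw [coeff_vecPoly, dif_neg (by omega)]

theorem vecPoly_injective : Function.Injective (vecPoly : (Fin n → F) → F[X]) := by
  intro f g h
  funext i
  rw [← coeff_vecPoly_fin f, h, coeff_vecPoly_fin]

theorem vecPoly_sub (f g : Fin n → F) : vecPoly (f - g) = vecPoly f - vecPoly g := by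
  simp [vecPoly, sub_mul, Finset.sum_sub_distrib]

theorem vecPoly_add (f g : Fin n → F) : vecPoly (f + g) = vecPoly f + vecPoly g := by
  simp [vecPoly, add_mul, Finset.sum_add_distrib]

theorem vecPoly_smul (a : F) (f : Fin n → F) : vecPoly (a • f) = C a * vecPoly f := by
  simp [vecPoly, Finset.mul_sum, mul_assoc]

theorem vecPoly_coeff {p : F[X]} (hp : p.degree < n) :
    vecPoly (fun i : Fin n => p.coeff i) = p := by
  ext k
  rw [coeff_vecPoly]
  split_ifs with h
  · rfl
  · exact (coeff_eq_zero_of_degree_lt (hp.trans_le (by exact_mod_cast Nat.le_of_not_lt h))).symm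

end VecPoly

section Jets

variable {F : Type*} [Field F] {n s : ℕ}

/-- The polynomial curve `(X, p, p', …, p^(s))`, whose points over `F` are the neighbours of `p`
in the KT graph. -/
noncomputable def jetCurve (s : ℕ) (p : F[X]) : Fin (s + 2) → F[X] :=
  Fin.cons X fun j : Fin (s + 1) => derivative^[(j : ℕ)] p

theorem eval_jetCurve (f : Fin n → F) (y : F) (i : Fin (s + 2)) :
    (jetCurve s (vecPoly f) i).eval y = ktNbr s f y i := by
  induction i using Fin.cases <;> simp [jetCurve, ktNbr]

theorem eval_aeval_jetCurve (f : Fin n → F) (y : F) (Q : MvPolynomial (Fin (s + 2)) F) :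
    (MvPolynomial.aeval (jetCurve s (vecPoly f)) Q).eval y =
      MvPolynomial.eval (ktNbr s f y) Q := by
  rw [← Polynomial.coe_aeval_eq_eval, ← AlgHom.comp_apply, MvPolynomial.comp_aeval,
    ← MvPolynomial.aeval_eq_eval]
  simp only [Polynomial.coe_aeval_eq_eval, eval_jetCurve]

theorem natDegree_jetCurve_le {p : F[X]} (hn : 1 ≤ n) (hp : p.degree < n) (i : Fin (s + 2)) :
    (jetCurve s p i).natDegree ≤ n := by
  induction i using Fin.cases with
  | zero => simpa [jetCurve] using hn
  | succ j =>
    simp only [jetCurve, Fin.cons_succ]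
    refine (natDegree_iterate_derivative p j).trans ((Nat.sub_le _ _).trans ?_)
    exact natDegree_le_of_degree_le hp.le

theorem pow_dvd_iff_iterate_derivative_eval_eq_zero {p : F[X]} {y : F}
    (hs : ∀ k ≤ s, k ≠ 0 → (k : F) ≠ 0) :
    (X - C y) ^ (s + 1) ∣ p ↔ ∀ k ≤ s, (derivative^[k] p).eval y = 0 := by
  rcases eq_or_ne p 0 with rfl | hp
  · simp
  rw [← le_rootMultiplicity_iff hp, Nat.succ_le_iff,
    lt_rootMultiplicity_iff_isRoot_iterate_derivative_of_mem_nonZeroDivisors' hp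
      fun m hm hm0 => mem_nonZeroDivisors_of_ne_zero (hs m hm hm0)]
  rfl

/-- Hermite interpolation data: `f` and `g` have the same neighbour over `y` exactly when they
agree at `y` to order `s + 1`. -/
theorem ktNbr_eq_iff (hs : ∀ k ≤ s, k ≠ 0 → (k : F) ≠ 0) (f g : Fin n → F) (y z : F) :
    ktNbr s f y = ktNbr s g z ↔ y = z ∧ (X - C y) ^ (s + 1) ∣ vecPoly f - vecPoly g := by
  rw [pow_dvd_iff_iterate_derivative_eval_eq_zero hs]
  constructor
  · intro h
    have h0 : y = z := by simpa [ktNbr] using congrFun h 0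
    subst h0
    refine ⟨rfl, fun k hk => ?_⟩
    have := congrFun h (Fin.succ ⟨k, Nat.lt_succ_of_le hk⟩)
    simp only [ktNbr, Fin.cons_succ] at this
    rw [iterate_derivative_sub, eval_sub, this, sub_self]
  · rintro ⟨rfl, h⟩
    funext i
    induction i using Fin.cases with
    | zero => simp [ktNbr]
    | succ j =>
      have := h j (Nat.le_of_lt_succ j.2)
      rw [iterate_derivative_sub, eval_sub, sub_eq_zero] at this
      simpa [ktNbr] using this

/-! ### Uniqueness for differential equations and the expansion of the KT graph -/

/-- A solution of the differential equation `Q(X, p, p', …, p^(j)) = 0` is determined, among the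
solutions of degree less than the characteristic, by its jet at any point where the separant
`∂Q/∂p^(j)` does not vanish. If `g - f` had a zero of order `m > s` at `y`, Taylor expansion
modulo `(X - y)^(m - j + 1)` would leave only the term `∂Q/∂p^(j) · (g - f)^(j)`, which has a zero
of order exactly `m - j`. -/
theorem eq_of_separant_eval_ne_zero (hn : ∀ k < n, k ≠ 0 → (k : F) ≠ 0) {f g : F[X]}
    (hf : f.degree < n) (hg : g.degree < n) {Q : MvPolynomial (Fin (s + 2)) F} {j : Fin (s + 1)}
    (hvars : ∀ i ∈ Q.vars, i ≤ j.succ)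
    (hQf : MvPolynomial.aeval (jetCurve s f) Q = 0) (hQg : MvPolynomial.aeval (jetCurve s g) Q = 0)
    {y : F} (hsep : (MvPolynomial.aeval (jetCurve s f) (MvPolynomial.pderiv j.succ Q)).eval y ≠ 0)
    (hdvd : (X - C y) ^ (s + 1) ∣ g - f) : f = g := by
  by_contra hne
  have hu0 : g - f ≠ 0 := sub_ne_zero.2 (Ne.symm hne)
  set m := (g - f).rootMultiplicity y with hm
  have hsm : s + 1 ≤ m := (le_rootMultiplicity_iff hu0).2 hdvd
  have hjs : (j : ℕ) ≤ s := Nat.le_of_lt_succ j.2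
  have hmn : m < n := by
    have h1 : m ≤ (g - f).natDegree :=
      (rootMultiplicity_le_iff hu0 y _).2 fun h => by
        have := natDegree_le_of_dvd h hu0
        rw [natDegree_pow, natDegree_X_sub_C] at this
        omega
    have h2 : (g - f).degree < n := (degree_sub_le g f).trans_lt (max_lt hg hf)
    exact h1.trans_lt ((natDegree_lt_iff_degree_lt hu0).2 h2)
  have hmdvd : (X - C y) ^ m ∣ g - f := pow_rootMultiplicity_dvd _ _
  have hder : ∀ k : ℕ, (X - C y) ^ (m - k) ∣ derivative^[k] g - derivative^[k] f := fun k => by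
    rw [← iterate_derivative_sub]
    exact pow_sub_dvd_iterate_derivative_of_pow_dvd k hmdvd
  -- The equation does not see the coordinates beyond `j`; they are set to zero.
  let a : Fin (s + 2) → F[X] := fun i => if i ≤ j.succ then jetCurve s f i else 0
  let b : Fin (s + 2) → F[X] := fun i => if i ≤ j.succ then jetCurve s g i else 0
  have ha : ∀ P : MvPolynomial (Fin (s + 2)) F, P.vars ⊆ Q.vars →
      MvPolynomial.aeval a P = MvPolynomial.aeval (jetCurve s f) P := fun P hP =>
    MvPolynomial.aeval_congr_of_vars P fun i hi => if_pos (hvars i (hP hi))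
  have hb : MvPolynomial.aeval b Q = MvPolynomial.aeval (jetCurve s g) Q :=
    MvPolynomial.aeval_congr_of_vars Q fun i hi => if_pos (hvars i hi)
  have hdiff : b j.succ - a j.succ = derivative^[(j : ℕ)] g - derivative^[(j : ℕ)] f := by
    simp [a, b, jetCurve]
  have key := MvPolynomial.aeval_sub_aeval_sub_pderiv_mul_mem
    (Ideal.span {(X - C y) ^ (m - j + 1)}) j.succ a b ?_ ?_ Q
  · rw [ha Q subset_rfl, hb, hQf, hQg, ha _ (MvPolynomial.vars_pderiv_subset Q _), hdiff,
      sub_zero, zero_sub, Ideal.neg_mem_iff, Ideal.mem_span_singleton] at key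
    have hcop : IsCoprime ((X - C y) ^ (m - j + 1))
        (MvPolynomial.aeval (jetCurve s f) (MvPolynomial.pderiv j.succ Q)) := by
      refine IsCoprime.pow_left ((irreducible_X_sub_C y).coprime_iff_not_dvd.2 ?_)
      rwa [dvd_iff_isRoot]
    have h1 := hcop.dvd_of_dvd_mul_left key
    rw [← iterate_derivative_sub] at h1
    have h2 : (derivative^[m] (g - f)).eval y = 0 := by
      have h3 := pow_sub_dvd_iterate_derivative_of_pow_dvd (m - j) h1
      rw [Nat.add_sub_cancel_left, pow_one, ← Function.iterate_add_apply,
        Nat.sub_add_cancel (by omega), dvd_iff_isRoot] at h3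
      exact h3
    have h4 : (X - C y) ^ (m + 1) ∣ g - f :=
      (pow_dvd_iff_iterate_derivative_eval_eq_zero fun k hk => hn k (by omega)).2 fun k hk => by
        rcases hk.lt_or_eq with hk | rfl
        · exact isRoot_iterate_derivative_of_lt_rootMultiplicity (hm ▸ hk)
        · exact h2
    have := (le_rootMultiplicity_iff hu0).2 h4
    omega
  · intro i hi
    rw [Ideal.mem_span_singleton]
    by_cases hij : i ≤ j.succ
    · simp only [a, b, if_pos hij]
      induction i using Fin.cases with
      | zero => simp [jetCurve]
      | succ k =>
        simp only [jetCurve, Fin.cons_succ]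
        have hkj : (k : ℕ) < j := by
          have h1 : k ≤ j := by simpa using hij
          have h2 : k ≠ j := fun h => hi (by rw [h])
          exact lt_of_le_of_ne h1 (fun h => h2 (Fin.ext h))
        exact (pow_dvd_pow _ (by omega)).trans (hder k)
    · simp [a, b, if_neg hij]
  · rw [Ideal.mem_span_singleton, hdiff]
    refine (pow_dvd_pow _ ?_).trans ((pow_mul (X - C y) (m - j) 2).dvd.trans
      (pow_dvd_pow_of_dvd (hder j) 2))
    omega

section Expansion

variable [Fintype F]

open Classical in
/-- The neighbourhood in the KT graph of a finite set of left vertices. -/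
noncomputable def ktNbrs (s : ℕ) (S : Finset (Fin n → F)) : Finset (Fin (s + 2) → F) :=
  S.biUnion fun f => Finset.univ.image (ktNbr s f)

theorem mem_ktNbrs {S : Finset (Fin n → F)} {z : Fin (s + 2) → F} :
    z ∈ ktNbrs s S ↔ ∃ f ∈ S, ∃ y, ktNbr s f y = z := by
  simp [ktNbrs]

theorem card_ktNbrs_le (S : Finset (Fin n → F)) :
    (ktNbrs s S).card ≤ S.card * Fintype.card F := by
  classical
  refine Finset.card_biUnion_le_card_mul _ _ _ fun f _ => ?_
  exact Finset.card_image_le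

/-- Among the members of a small set `S` some `f` shares few of its right neighbours with the rest
of `S`. A nonzero polynomial `Q` that vanishes on all right neighbours of `S` and has least total
degree gives a differential equation satisfied by all of `S` whose separant is not zero on some
`f ∈ S`; only zeros of the separant can be shared. -/
theorem exists_card_shared_le {S : Finset (Fin n → F)} (hS : S.Nonempty) (hn1 : 1 ≤ n)
    (hF : ∀ k < Fintype.card F, k ≠ 0 → (k : F) ≠ 0) (hnF : n ≤ Fintype.card F) (hsn : s < n)
    {h : ℕ} (hh : S.card * Fintype.card F < h ^ (s + 2))
    (hcard : (s + 2) * (h * n) ≤ Fintype.card F) :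
    ∃ f ∈ S, ∃ B : Finset F, B.card ≤ (s + 2) * (h * n) ∧
      ∀ y ∉ B, ∀ g ∈ S, g ≠ f → ∀ z, ktNbr s g z ≠ ktNbr s f y := by
  classical
  have h0 : 0 < h := Nat.pos_of_ne_zero fun h0 => by simp [h0] at hh
  -- `good Q` says that `Q` is a nonzero equation of small degree satisfied by `S`.
  let good : MvPolynomial (Fin (s + 2)) F → Prop := fun Q => Q ≠ 0 ∧
    (∀ m ∈ Q.support, ∀ i, m i < h) ∧
    ∀ f ∈ S, MvPolynomial.aeval (jetCurve s (vecPoly f)) Q = 0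
  have hdeg : ∀ Q : MvPolynomial (Fin (s + 2)) F, (∀ m ∈ Q.support, ∀ i, m i < h) →
      ∀ f : Fin n → F, (MvPolynomial.aeval (jetCurve s (vecPoly f)) Q).natDegree
        < (s + 2) * (h * n) := by
    intro Q hQ f
    have := MvPolynomial.natDegree_aeval_le (h := h - 1) (d := n)
      (fun m hm i => Nat.le_pred_of_lt (hQ m hm i))
      (natDegree_jetCurve_le (s := s) hn1 (degree_vecPoly_lt f))
    rw [Fintype.card_fin] at this
    refine this.trans_lt ?_
    gcongr
    omega
  have hex : ∃ Q, good Q := by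
    obtain ⟨Q, hQ0, hQd, hQ⟩ := MvPolynomial.exists_ne_zero_eval_eq_zero (h := h) (ktNbrs s S)
      (by rw [Fintype.card_fin]; exact (card_ktNbrs_le S).trans_lt hh)
    refine ⟨Q, hQ0, hQd, fun f hf => ?_⟩
    refine eq_zero_of_natDegree_lt_card_of_eval_eq_zero _ Function.injective_id (fun y => ?_)
      ((hdeg Q hQd f).trans_le hcard)
    rw [id, eval_aeval_jetCurve]
    exact hQ _ (mem_ktNbrs.2 ⟨f, hf, y, rfl⟩)
  obtain ⟨Q, hQ, hmin⟩ : ∃ Q, good Q ∧ ∀ P, good P → Q.totalDegree ≤ P.totalDegree := by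
    have := WellFounded.has_min (measure fun Q : MvPolynomial (Fin (s + 2)) F => Q.totalDegree).wf
      {Q | good Q} hex
    obtain ⟨Q, hQ, hm⟩ := this
    exact ⟨Q, hQ, fun P hP => not_lt.1 (hm P hP)⟩
  obtain ⟨hQ0, hQd, hQS⟩ := hQ
  -- The equation involves a derivative of the unknown: `Q(X) = 0` alone forces `Q = 0`.
  have hvar : ∃ j : Fin (s + 1), j.succ ∈ Q.vars := by
    by_contra hno
    push Not at hno
    obtain ⟨f, hf⟩ := hS
    have hv : ∀ i ∈ Q.vars, i = 0 := fun i hi => by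
      induction i using Fin.cases with
      | zero => rfl
      | succ j => exact absurd hi (hno j)
    apply hQ0
    have h1 := hQS f hf
    rw [MvPolynomial.aeval_congr_of_vars (b := fun _ => X) Q
      (fun i hi => by rw [hv i hi]; simp [jetCurve])] at h1
    have h2 := congrArg (Polynomial.aeval (MvPolynomial.X (R := F) (0 : Fin (s + 2)))) h1
    rw [← AlgHom.comp_apply, MvPolynomial.comp_aeval, map_zero] at h2
    rw [← h2, ← MvPolynomial.aeval_congr_of_vars (a := MvPolynomial.X) Q
      (fun i hi => by rw [hv i hi]; simp), MvPolynomial.aeval_X_left_apply]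
  obtain ⟨j, hj, hjmax⟩ : ∃ j : Fin (s + 1), j.succ ∈ Q.vars ∧ ∀ i ∈ Q.vars, i ≤ j.succ := by
    obtain ⟨j, hj⟩ := hvar
    have hmax := Finset.max'_mem Q.vars ⟨_, hj⟩
    have hle : j.succ ≤ Q.vars.max' ⟨_, hj⟩ := Finset.le_max' _ _ hj
    obtain ⟨k, hk⟩ := Fin.exists_succ_eq.2
      (show Q.vars.max' ⟨_, hj⟩ ≠ 0 from fun h0 => by rw [h0] at hle; simp at hle)
    exact ⟨k, hk ▸ hmax, fun i hi => hk ▸ Finset.le_max' _ _ hi⟩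
  set P := MvPolynomial.pderiv j.succ Q with hP
  have hP0 : P ≠ 0 := by
    rw [MvPolynomial.mem_vars_iff_mem_support] at hj
    obtain ⟨d, hd, hdj⟩ := hj
    have hdj' : 1 ≤ d j.succ := Nat.one_le_iff_ne_zero.2 (Finsupp.mem_support_iff.1 hdj)
    intro h0
    have h1 : MvPolynomial.coeff (d - Finsupp.single j.succ 1) P = 0 := by rw [h0]; simp
    rw [hP, MvPolynomial.coeff_pderiv, tsub_add_cancel_of_le
      (Finsupp.single_le_iff.2 hdj')] at h1
    rcases mul_eq_zero.1 h1 with h2 | h2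
    · exact (MvPolynomial.mem_support_iff.1 hd) h2
    · refine hF (d j.succ) ?_ (by omega) ?_
      · have h3 := hQd d hd j.succ
        have h4 : h ≤ (s + 2) * (h * n) := by 
          nlinarith [Nat.mul_le_mul_left h hn1, Nat.zero_le (s * (h * n))]
        omega
      · rw [← h2, Finsupp.tsub_apply, Finsupp.single_eq_same]
        norm_cast
        rw [Nat.sub_add_cancel hdj']
  have hPd : ∀ m ∈ P.support, ∀ i, m i < h := fun m hm i => by
    have := hQd _ (MvPolynomial.add_single_mem_support_of_mem_support_pderiv hm) i
    rw [Finsupp.add_apply] at this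
    omega
  obtain ⟨f, hf, hPf⟩ : ∃ f ∈ S, MvPolynomial.aeval (jetCurve s (vecPoly f)) P ≠ 0 := by
    by_contra hno
    push Not at hno
    exact absurd (hmin P ⟨hP0, hPd, hno⟩) (not_le.2 (MvPolynomial.totalDegree_pderiv_lt hP0))
  refine ⟨f, hf, (MvPolynomial.aeval (jetCurve s (vecPoly f)) P).roots.toFinset,
    (Multiset.toFinset_card_le _).trans ((card_roots' _).trans (hdeg P hPd f).le), ?_⟩
  intro y hy g hg hgf z hz
  rw [ktNbr_eq_iff (fun k hk => hF k (by omega))] at hz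
  rw [Multiset.mem_toFinset, mem_roots hPf] at hy
  obtain ⟨rfl, hd⟩ := hz
  exact hgf (vecPoly_injective (eq_of_separant_eval_ne_zero (fun k hk => hF k (by omega))
    (degree_vecPoly_lt f) (degree_vecPoly_lt g) hjmax (hQS f hf) (hQS g hg) hy hd)).symm

/-- The KT graph is an expander: removing the vertices supplied by `exists_card_shared_le` one by
one, each of them contributes at least `|F| - (s + 2) h n` new neighbours. -/
theorem mul_card_le_card_ktNbrs (hn1 : 1 ≤ n)
    (hF : ∀ k < Fintype.card F, k ≠ 0 → (k : F) ≠ 0) (hnF : n ≤ Fintype.card F) (hsn : s < n)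
    {h : ℕ} (hcard : (s + 2) * (h * n) ≤ Fintype.card F) (S : Finset (Fin n → F))
    (hh : S.card * Fintype.card F < h ^ (s + 2)) :
    (Fintype.card F - (s + 2) * (h * n)) * S.card ≤ (ktNbrs s S).card := by
  classical
  induction hk : S.card generalizing S with
  | zero => simp
  | succ k ih =>
    obtain ⟨f, hf, B, hB, hfB⟩ :=
      exists_card_shared_le (Finset.card_pos.1 (by omega)) hn1 hF hnF hsn hh hcard
    have hek : (S.erase f).card = k := by rw [Finset.card_erase_of_mem hf, hk]; rfl
    have h1 := ih (S.erase f) (lt_of_le_of_lt (Nat.mul_le_mul_right _ (by omega)) hh) hek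
    have hinj : Function.Injective (ktNbr s f) := fun y z hyz => by
      simpa [ktNbr] using congrFun hyz 0
    have hdisj : Disjoint (ktNbrs s (S.erase f)) (Bᶜ.image (ktNbr s f)) := by
      rw [Finset.disjoint_left]
      intro z hz hz'
      obtain ⟨g, hg, w, rfl⟩ := mem_ktNbrs.1 hz
      obtain ⟨y, hy, hyz⟩ := Finset.mem_image.1 hz'
      exact hfB y (Finset.mem_compl.1 hy) g (Finset.mem_of_mem_erase hg)
        (Finset.ne_of_mem_erase hg) w hyz.symm
    have hsub : ktNbrs s (S.erase f) ∪ Bᶜ.image (ktNbr s f) ⊆ ktNbrs s S := by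
      intro z hz
      rw [mem_ktNbrs]
      rcases Finset.mem_union.1 hz with hz | hz
      · obtain ⟨g, hg, w, hw⟩ := mem_ktNbrs.1 hz
        exact ⟨g, Finset.mem_of_mem_erase hg, w, hw⟩
      · obtain ⟨y, -, hy⟩ := Finset.mem_image.1 hz
        exact ⟨f, hf, y, hy⟩
    have h2 := Finset.card_le_card hsub
    rw [Finset.card_union_of_disjoint hdisj, Finset.card_image_of_injective _ hinj,
      Finset.card_compl] at h2
    rw [Nat.mul_succ]
    omega

end Expansion

end Jets

/-! ### The bipartite half of the KT graph -/

/-- A lower Bonferroni inequality for sets of equal size with small pairwise intersections. -/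
theorem Finset.card_mul_le_card_biUnion_add {ι α : Type*} [DecidableEq ι] [DecidableEq α]
    {a b : ℕ} (T : Finset ι) (A : ι → Finset α) (hA : ∀ z ∈ T, (A z).card = a)
    (hAA : ∀ z ∈ T, ∀ w ∈ T, z ≠ w → (A z ∩ A w).card ≤ b) :
    T.card * a ≤ (T.biUnion A).card + T.card * (T.card * b) := by
  induction T using Finset.induction_on with
  | empty => simp
  | insert z T hz ih =>
    have ih' := ih (fun w hw => hA w (Finset.mem_insert_of_mem hw)) fun v hv w hw =>
      hAA v (Finset.mem_insert_of_mem hv) w (Finset.mem_insert_of_mem hw)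
    have h1 := Finset.card_union_add_card_inter (A z) (T.biUnion A)
    have h2 : (A z ∩ T.biUnion A).card ≤ T.card * b := by
      rw [Finset.inter_biUnion]
      refine Finset.card_biUnion_le_card_mul _ _ _ fun w hw => ?_
      exact hAA z (Finset.mem_insert_self _ _) w (Finset.mem_insert_of_mem hw)
        fun h => hz (h ▸ hw)
    rw [hA z (Finset.mem_insert_self _ _)] at h1
    rw [Finset.biUnion_insert, Finset.card_insert_of_notMem hz]
    have h3 : (T.card + 1) * ((T.card + 1) * b) =
        T.card * (T.card * b) + T.card * b + (T.card * b + b) := by ring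
    have h4 : (T.card + 1) * a = T.card * a + a := by ring
    omega

section Multiples

variable {F : Type*} [Field F] {n : ℕ}

/-- The vector of the first `n` coefficients of the multiple `M * t` of a polynomial `M`. It loses
nothing when `t` has at most `n - M.natDegree` coefficients. -/
noncomputable def mulVec {m : ℕ} (n : ℕ) (M : F[X]) (t : Fin m → F) : Fin n → F :=
  fun i => (M * vecPoly t).coeff i

theorem vecPoly_mulVec {m : ℕ} {M : F[X]} (hm : m ≤ n - M.natDegree) (t : Fin m → F) :
    vecPoly (mulVec n M t) = M * vecPoly t := by
  refine vecPoly_coeff ?_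
  rcases eq_or_ne (M * vecPoly t) 0 with h0 | h0
  · simp [h0]
  · have ht : vecPoly t ≠ 0 := right_ne_zero_of_mul h0
    rw [← natDegree_lt_iff_degree_lt h0, natDegree_mul (left_ne_zero_of_mul h0) ht]
    have := (natDegree_lt_iff_degree_lt ht).2 (degree_vecPoly_lt t)
    omega

theorem mulVec_injective {m : ℕ} {M : F[X]} (hm : m ≤ n - M.natDegree) (hM : M ≠ 0) :
    Function.Injective (mulVec n M : (Fin m → F) → Fin n → F) := by
  intro t u h
  have := congrArg vecPoly h
  rw [vecPoly_mulVec hm, vecPoly_mulVec hm] at this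
  exact vecPoly_injective (mul_left_cancel₀ hM this)

theorem dvd_vecPoly_iff {M : F[X]} (hM : M ≠ 0) {f : Fin n → F} :
    M ∣ vecPoly f ↔ ∃ t : Fin (n - M.natDegree) → F, mulVec n M t = f := by
  constructor
  · rintro ⟨w, hw⟩
    have hwd : w.degree < (n - M.natDegree : ℕ) := by
      rcases eq_or_ne w 0 with rfl | hw0
      · simp
      have h1 : M * w ≠ 0 := mul_ne_zero hM hw0
      have h2 := degree_vecPoly_lt f
      rw [hw, ← natDegree_lt_iff_degree_lt h1, natDegree_mul hM hw0] at h2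
      rw [← natDegree_lt_iff_degree_lt hw0]
      omega
    refine ⟨fun i => w.coeff i, vecPoly_injective ?_⟩
    rw [vecPoly_mulVec le_rfl, vecPoly_coeff hwd, hw]
  · rintro ⟨t, rfl⟩
    rw [vecPoly_mulVec le_rfl]
    exact dvd_mul_right _ _

open Classical in
theorem card_filter_dvd_vecPoly_sub [Fintype F] {M : F[X]} (hM : M ≠ 0) (g : Fin n → F) :
    (Finset.univ.filter fun f : Fin n → F => M ∣ vecPoly f - vecPoly g).card =
      Fintype.card F ^ (n - M.natDegree) := by
  have : (Finset.univ.filter fun f : Fin n → F => M ∣ vecPoly f - vecPoly g) =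
      Finset.univ.image fun t : Fin (n - M.natDegree) → F => mulVec n M t + g := by
    ext f
    simp only [Finset.mem_filter, Finset.mem_univ, true_and, Finset.mem_image]
    rw [← vecPoly_sub, dvd_vecPoly_iff hM]
    exact exists_congr fun t => eq_sub_iff_add_eq
  rw [this, Finset.card_image_of_injective _
    (fun t u h => mulVec_injective le_rfl hM (add_right_cancel h))]
  simp

end Multiples

section Half

variable {F : Type*} [Field F] {n s : ℕ}

theorem natDegree_X_sub_C_pow (y : F) (k : ℕ) : ((X - C y) ^ k).natDegree = k := by
  rw [natDegree_pow, natDegree_X_sub_C, mul_one]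

theorem X_sub_C_pow_ne_zero (y : F) (k : ℕ) : (X - C y) ^ k ≠ 0 :=
  pow_ne_zero _ (X_sub_C_ne_zero y)

theorem ktHalf_adj_iff (hs : ∀ k ≤ s, k ≠ 0 → (k : F) ≠ 0) (f g : Fin n → F) :
    (ktHalf F n s).Adj f g ↔ ∃ y : F, (X - C y) ^ (s + 1) ∣ vecPoly g - vecPoly f := by
  constructor
  · rintro ⟨r, ⟨y, rfl⟩, z, hz⟩
    obtain ⟨rfl, h⟩ := (ktNbr_eq_iff hs f g y z).1 hz
    exact ⟨y, by rwa [dvd_sub_comm]⟩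
  · rintro ⟨y, hy⟩
    exact ⟨ktNbr s f y, ⟨y, rfl⟩, y, (ktNbr_eq_iff hs f g y y).2 ⟨rfl, by rwa [dvd_sub_comm]⟩⟩

/-- The graph is a Cayley graph of the additive group, hence regular. -/
theorem ktHalf_isRegular [Fintype F] (hs : ∀ k ≤ s, k ≠ 0 → (k : F) ≠ 0) :
    (ktHalf F n s).IsRegular ((ktHalf F n s).nbrs 0).ncard := by
  intro v
  refine ⟨Set.toFinite _, ?_⟩
  rw [← Set.ncard_image_of_injective ((ktHalf F n s).nbrs 0) (add_right_injective v)]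
  congr 1
  ext g
  simp only [LoopGraph.nbrs, Set.mem_ofPred_eq, Set.mem_image]
  constructor
  · intro h
    refine ⟨g - v, ?_, by simp⟩
    rw [ktHalf_adj_iff hs] at h ⊢
    simpa [← vecPoly_sub] using h
  · rintro ⟨u, hu, rfl⟩
    rw [ktHalf_adj_iff hs] at hu ⊢
    simpa [← vecPoly_sub] using hu

theorem pow_le_ncard_nbrs_ktHalf [Fintype F] (hs : ∀ k ≤ s, k ≠ 0 → (k : F) ≠ 0) :
    Fintype.card F ^ (n - (s + 1)) ≤ ((ktHalf F n s).nbrs 0).ncard := by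
  classical
  have h := card_filter_dvd_vecPoly_sub (n := n) (X_sub_C_pow_ne_zero (0 : F) (s + 1)) 0
  rw [natDegree_X_sub_C_pow] at h
  rw [← h, ← Set.ncard_coe_finset]
  refine Set.ncard_le_ncard (fun g hg => ?_) (Set.toFinite _)
  exact (ktHalf_adj_iff hs 0 g).2 ⟨0, by simpa using hg⟩

theorem ncard_nbrs_ktHalf_le [Fintype F] (hs : ∀ k ≤ s, k ≠ 0 → (k : F) ≠ 0) :
    ((ktHalf F n s).nbrs 0).ncard ≤ Fintype.card F * Fintype.card F ^ (n - (s + 1)) := by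
  classical
  have h : (ktHalf F n s).nbrs 0 ⊆ ((Finset.univ : Finset F).biUnion fun y =>
      Finset.univ.filter fun f : Fin n → F =>
        (X - C y) ^ (s + 1) ∣ vecPoly f - vecPoly (0 : Fin n → F) : Finset (Fin n → F)) := by
    intro g hg
    obtain ⟨y, hy⟩ := (ktHalf_adj_iff hs 0 g).1 hg
    simp only [Finset.coe_biUnion, Set.mem_iUnion]
    exact ⟨y, by simp, by simpa using hy⟩
  refine (Set.ncard_le_ncard h (Finset.finite_toSet _)).trans ?_
  rw [Set.ncard_coe_finset]
  refine Finset.card_biUnion_le_card_mul _ _ _ fun y _ => ?_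
  rw [card_filter_dvd_vecPoly_sub (X_sub_C_pow_ne_zero y (s + 1)), natDegree_X_sub_C_pow]

/-- Every right vertex has `q ^ (n - (s + 1))` left neighbours and two right vertices have at most
`q ^ (n - 2 (s + 1))` (truncated exponent) common ones, by the Chinese remainder theorem. -/
theorem card_ktNbrs_mul_le_ncard_nbrsOf [Fintype F] (hs : ∀ k ≤ s, k ≠ 0 → (k : F) ≠ 0)
    (S : Finset (Fin n → F)) :
    (ktNbrs s S).card * Fintype.card F ^ (n - (s + 1)) ≤
      ((ktHalf F n s).nbrsOf S).ncard +
        (ktNbrs s S).card * ((ktNbrs s S).card * Fintype.card F ^ (n - 2 * (s + 1))) := by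
  classical
  let A : (Fin (s + 2) → F) → Finset (Fin n → F) := fun z =>
    Finset.univ.filter fun g => ∃ y, ktNbr s g y = z
  have hAeq : ∀ (f : Fin n → F) y, A (ktNbr s f y) = Finset.univ.filter fun g : Fin n → F =>
      (X - C y) ^ (s + 1) ∣ vecPoly g - vecPoly f := by
    intro f y
    refine Finset.filter_congr fun g _ => ?_
    constructor
    · rintro ⟨z, hz⟩
      obtain ⟨rfl, h⟩ := (ktNbr_eq_iff hs g f z y).1 hz
      exact h
    · exact fun h => ⟨y, (ktNbr_eq_iff hs g f y y).2 ⟨rfl, h⟩⟩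
  refine (Finset.card_mul_le_card_biUnion_add (b := Fintype.card F ^ (n - 2 * (s + 1)))
    (ktNbrs s S) A ?_ ?_).trans (Nat.add_le_add_right ?_ _)
  · intro z hz
    obtain ⟨f, -, y, rfl⟩ := mem_ktNbrs.1 hz
    rw [hAeq, card_filter_dvd_vecPoly_sub (X_sub_C_pow_ne_zero y (s + 1)), natDegree_X_sub_C_pow]
  · intro z _ w _ hzw
    rcases (A z ∩ A w).eq_empty_or_nonempty with h0 | ⟨g, hg⟩
    · simp [h0]
    obtain ⟨hgz, hgw⟩ := Finset.mem_inter.1 hg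
    obtain ⟨y, rfl⟩ := (Finset.mem_filter.1 hgz).2
    obtain ⟨x, rfl⟩ := (Finset.mem_filter.1 hgw).2
    have hyx : y ≠ x := fun h => hzw (h ▸ rfl)
    have hcop : IsCoprime ((X - C y) ^ (s + 1)) ((X - C x) ^ (s + 1)) :=
      IsCoprime.pow (isCoprime_X_sub_C_of_isUnit_sub (sub_ne_zero.2 hyx).isUnit)
    have hM : (X - C y) ^ (s + 1) * (X - C x) ^ (s + 1) ≠ 0 :=
      mul_ne_zero (X_sub_C_pow_ne_zero y _) (X_sub_C_pow_ne_zero x _)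
    have hdeg : ((X - C y) ^ (s + 1) * (X - C x) ^ (s + 1)).natDegree = 2 * (s + 1) := by
      rw [natDegree_mul (X_sub_C_pow_ne_zero y _) (X_sub_C_pow_ne_zero x _),
        natDegree_X_sub_C_pow, natDegree_X_sub_C_pow]
      ring
    rw [← hdeg, ← card_filter_dvd_vecPoly_sub hM g, hAeq, hAeq]
    refine Finset.card_le_card fun f hf => ?_
    simp only [Finset.mem_inter, Finset.mem_filter, Finset.mem_univ, true_and] at hf ⊢
    exact hcop.mul_dvd hf.1 hf.2
  · rw [← Set.ncard_coe_finset]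
    refine Set.ncard_le_ncard (fun g hg => ?_) (Set.toFinite _)
    simp only [Finset.coe_biUnion, Set.mem_iUnion] at hg
    obtain ⟨z, hz, hgz⟩ := hg
    obtain ⟨f, hf, y, rfl⟩ := mem_ktNbrs.1 (Finset.mem_coe.1 hz)
    obtain ⟨x, hx⟩ := (Finset.mem_filter.1 (Finset.mem_coe.1 hgz)).2
    exact ⟨f, hf, ktNbr s f y, ⟨y, rfl⟩, x, hx.symm⟩

/-- Three multiples of `X ^ (s + 1)` form a triangle. -/
theorem not_isBipartite_ktHalf (hs : ∀ k ≤ s, k ≠ 0 → (k : F) ≠ 0) (hsn : s + 1 < n)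
    (h2 : (2 : F) ≠ 0) : ¬ (ktHalf F n s).IsBipartite := by
  rintro ⟨c, hc⟩
  let v : Fin n → F := Pi.single ⟨s + 1, hsn⟩ 1
  have hvec : vecPoly v = X ^ (s + 1) := by
    ext k
    rw [coeff_vecPoly, coeff_X_pow]
    split_ifs with h1 h2 h2
    · subst h2; simp [v]
    · exact Pi.single_eq_of_ne (fun h => h2 (Fin.mk.inj_iff.1 h)) _
    · omega
    · rfl
  have hv : v ≠ 0 := fun h => by simpa [v] using congrFun h ⟨s + 1, hsn⟩
  have hadj : ∀ a b : F, (ktHalf F n s).Adj (a • v) (b • v) := fun a b => by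
    rw [ktHalf_adj_iff hs]
    refine ⟨0, ?_⟩
    rw [vecPoly_smul, vecPoly_smul, hvec, ← sub_mul]
    simp
  have hne : ∀ a b : F, a ≠ b → c (a • v) ≠ c (b • v) := fun a b hab =>
    hc _ _ (fun h => hab (smul_left_injective F hv h)) (hadj a b)
  have h01 := hne 0 1 zero_ne_one
  have h02 := hne 0 2 h2.symm
  have h12 := hne 1 2 (fun h => one_ne_zero (α := F) (by linear_combination -h))
  revert h01 h02 h12
  cases c ((0 : F) • v) <;> cases c ((1 : F) • v) <;> cases c ((2 : F) • v) <;> simp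

theorem exists_scaling_action (hs : ∀ k ≤ s, k ≠ 0 → (k : F) ≠ 0) :
    ∃ _ : MulAction Fˣ {f : Fin n → F // f ≠ 0},
      (∀ (a : Fˣ) (f : {f : Fin n → F // f ≠ 0}), (a • f).1 = (a : F) • f.1) ∧
      IsFreeAction Fˣ {f : Fin n → F // f ≠ 0} ∧
      ((ktHalf F n s).deleteVertex 0).IsInvariant Fˣ := by
  refine ⟨{ smul := fun a f => ⟨(a : F) • f.1, smul_ne_zero a.ne_zero f.2⟩
            one_smul := fun f => Subtype.ext (one_smul F f.1)
            mul_smul := fun a b f => Subtype.ext (mul_smul (a : F) (b : F) f.1) },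
    fun a f => rfl, ?_, ?_⟩
  · intro a f h
    have h1 : (a : F) • f.1 = (1 : F) • f.1 := by
      rw [one_smul]
      exact congrArg Subtype.val h
    exact Units.ext (smul_left_injective F f.2 h1)
  · intro a u v h
    have h' : (ktHalf F n s).Adj u.1 v.1 := h
    change (ktHalf F n s).Adj ((a : F) • u.1) ((a : F) • v.1)
    rw [ktHalf_adj_iff hs] at h' ⊢
    obtain ⟨y, hy⟩ := h'
    refine ⟨y, ?_⟩
    rw [vecPoly_smul, vecPoly_smul, ← mul_sub]
    exact hy.mul_left _

end Half

/-! ### A cost calculus for the random access machine -/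

/-- All numbers stored in the state are at most `B`. -/
def RamState.Bdd (B : ℕ) (σ : RamState) : Prop := (∀ r, σ.reg r ≤ B) ∧ ∀ i, σ.mem i ≤ B

/-- The state after assigning the value `v` to the register `d`. -/
def RamState.setReg (σ : RamState) (d v : ℕ) : RamState := ⟨Function.update σ.reg d v, σ.mem⟩

/-- The state after assigning the value `v` to the memory cell `p`. -/
def RamState.setMem (σ : RamState) (p v : ℕ) : RamState := ⟨σ.reg, Function.update σ.mem p v⟩

namespace RamState

variable (σ : RamState) (d v r : ℕ)

@[simp] theorem mem_setReg : (σ.setReg d v).mem = σ.mem := rfl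

@[simp] theorem reg_setMem : (σ.setMem d v).reg = σ.reg := rfl

@[simp] theorem reg_setReg_self : (σ.setReg d v).reg d = v := Function.update_self _ _ _

@[simp] theorem reg_setReg_of_ne {d v r : ℕ} (h : r ≠ d) : (σ.setReg d v).reg r = σ.reg r :=
  Function.update_of_ne h _ _

theorem mem_setMem : (σ.setMem d v).mem r = if r = d then v else σ.mem r :=
  Function.update_apply _ _ _ _

end RamState

namespace RamProg

/-- Started in `σ`, if all numbers there are at most `B`, the program `P` halts in a state that
satisfies `post`, after at most `k` elementary steps all of which handle numbers at most `B` only.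
Each such step costs at most `1 + 3 * B.size`. -/
def Halts (B : ℕ) (P : RamProg) (σ : RamState) (k : ℕ) (post : RamState → Prop) : Prop :=
  σ.Bdd B → ∃ τ t, P.Runs σ τ t ∧ t ≤ k * (1 + 3 * B.size) ∧ τ.Bdd B ∧ post τ

variable {B : ℕ} {σ : RamState} {P Q : RamProg} {k l : ℕ} {post mid : RamState → Prop}

theorem Halts.mono (h : Halts B P σ k mid) (hkl : k ≤ l) (hpost : ∀ τ, mid τ → post τ) :
    Halts B P σ l post := fun hσ => by
  obtain ⟨τ, t, hr, ht, hb, hm⟩ := h hσ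
  exact ⟨τ, t, hr, ht.trans (Nat.mul_le_mul_right _ hkl), hb, hpost τ hm⟩

theorem Halts.skip (h : post σ) : Halts B .skip σ 1 post := fun hσ =>
  ⟨σ, 1, .skip σ, by omega, hσ, h⟩

theorem Halts.seq (hP : Halts B P σ k mid) (hQ : ∀ τ, mid τ → Halts B Q τ l post) :
    Halts B (.seq P Q) σ (k + l) post := fun hσ => by
  obtain ⟨τ, t, hr, ht, hb, hm⟩ := hP hσ
  obtain ⟨υ, u, hr', hu, hb', hp⟩ := hQ τ hm hb
  exact ⟨υ, t + u, .seq hr hr', by rw [add_mul]; omega, hb', hp⟩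

theorem bdd_update_reg (hσ : σ.Bdd B) {d v : ℕ} (hv : v ≤ B) :
    RamState.Bdd B ⟨Function.update σ.reg d v, σ.mem⟩ := by
  refine ⟨fun r => ?_, hσ.2⟩
  by_cases h : r = d
  · subst h; simpa using hv
  · simpa [h] using hσ.1 r

theorem Halts.const {d c : ℕ} (hc : c ≤ B)
    (h : Halts B Q (σ.setReg d c) k post) :
    Halts B (.seq (.const d c) Q) σ (k + 1) post := fun hσ => by
  obtain ⟨τ, t, hr, ht, hb, hm⟩ := h (bdd_update_reg hσ hc)
  refine ⟨τ, _, .seq (.const σ d c) hr, ?_, hb, hm⟩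
  have := Nat.size_le_size hc
  rw [add_mul]
  omega

theorem Halts.arith {o : RamOp} {d a b : ℕ} (v : ℕ) (hv : o.eval (σ.reg a) (σ.reg b) = v)
    (hvB : v ≤ B) (h : Halts B Q (σ.setReg d v) k post) :
    Halts B (.seq (.arith o d a b) Q) σ (k + 1) post := fun hσ => by
  obtain ⟨τ, t, hr, ht, hb, hm⟩ := h (bdd_update_reg hσ hvB)
  subst hv
  refine ⟨τ, _, .seq (.arith σ o d a b) hr, ?_, hb, hm⟩
  have h1 := Nat.size_le_size hvB
  have h2 := Nat.size_le_size (hσ.1 a)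
  have h3 := Nat.size_le_size (hσ.1 b)
  rw [add_mul]
  omega

theorem Halts.load {d a : ℕ} (v : ℕ) (hv : σ.mem (σ.reg a) = v)
    (h : Halts B Q (σ.setReg d v) k post) :
    Halts B (.seq (.load d a) Q) σ (k + 1) post := fun hσ => by
  subst hv
  obtain ⟨τ, t, hr, ht, hb, hm⟩ := h (bdd_update_reg hσ (hσ.2 _))
  refine ⟨τ, _, .seq (.load σ d a) hr, ?_, hb, hm⟩
  have h2 := Nat.size_le_size (hσ.1 a)
  have h3 := Nat.size_le_size (hσ.2 (σ.reg a))
  rw [add_mul]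
  omega

theorem Halts.store {a b : ℕ} (p v : ℕ) (hp : σ.reg a = p) (hv : σ.reg b = v)
    (h : Halts B Q (σ.setMem p v) k post) :
    Halts B (.seq (.store a b) Q) σ (k + 1) post := fun hσ => by
  subst hp hv
  have hb' : (σ.setMem (σ.reg a) (σ.reg b)).Bdd B := by
    refine ⟨hσ.1, fun i => ?_⟩
    by_cases h : i = σ.reg a
    · simpa [RamState.mem_setMem, h] using hσ.1 b
    · simpa [RamState.mem_setMem, h] using hσ.2 i
  obtain ⟨τ, t, hr, ht, hb, hm⟩ := h hb'
  refine ⟨τ, _, .seq (.store σ a b) hr, ?_, hb, hm⟩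
  have h2 := Nat.size_le_size (hσ.1 a)
  have h3 := Nat.size_le_size (hσ.1 b)
  rw [add_mul]
  omega

theorem Halts.branch {a : ℕ} (hP : σ.reg a ≠ 0 → Halts B P σ k post)
    (hQ : σ.reg a = 0 → Halts B Q σ k post) : Halts B (.branch a P Q) σ (k + 1) post :=
  fun hσ => by
  have h2 := Nat.size_le_size (hσ.1 a)
  by_cases h : σ.reg a = 0
  · obtain ⟨τ, t, hr, ht, hb, hm⟩ := hQ h hσ
    exact ⟨τ, _, .branchFalse h hr, by rw [add_mul]; omega, hb, hm⟩
  · obtain ⟨τ, t, hr, ht, hb, hm⟩ := hP h hσ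
    exact ⟨τ, _, .branchTrue h hr, by rw [add_mul]; omega, hb, hm⟩

/-- Rule for loops with an invariant; the parameter of the invariant is the number of iterations
that remain. -/
theorem Halts.loop {a : ℕ} (inv : ℕ → RamState → Prop) (N : ℕ) (h0 : inv N σ)
    (hstep : ∀ i < N, ∀ τ, inv (i + 1) τ → τ.reg a ≠ 0 ∧ Halts B P τ k (inv i))
    (hdone : ∀ τ, inv 0 τ → τ.reg a = 0) :
    Halts B (.loop a P) σ (N * (k + 1) + 1) (inv 0) := by
  induction N generalizing σ with
  | zero => exact fun hσ => ⟨σ, 1, .loopDone (hdone σ h0), by omega, hσ, h0⟩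
  | succ N ih =>
    intro hσ
    obtain ⟨ha, hP⟩ := hstep N (Nat.lt_succ_self N) σ h0
    obtain ⟨τ, t, hr, ht, hb, hm⟩ := hP hσ
    obtain ⟨υ, u, hr', hu, hb', hp⟩ := ih hm (fun i hi => hstep i (by omega)) hb
    refine ⟨υ, _, .loopStep ha hr hr', ?_, hb', hp⟩
    have h2 := Nat.size_le_size (hσ.1 a)
    have h3 : (N + 1) * (k + 1) + 1 = k + 1 + (N * (k + 1) + 1) := by ring
    rw [h3, add_mul, add_mul]
    omega

theorem Halts.computesWithin {input output : List ℕ} {T : ℕ}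
    (h : Halts B P (RamState.init input) k fun τ => τ.HasOutput output)
    (hlen : input.length ≤ B) (hB : ∀ x ∈ input, x ≤ B) (hT : k * (1 + 3 * B.size) ≤ T) :
    P.ComputesWithin input output T := by
  obtain ⟨τ, t, hr, ht, -, hm⟩ := h ⟨fun r => by
    simp only [RamState.init]
    split_ifs
    · exact hlen
    · omega, fun i => by
    simp only [RamState.init, List.getD_eq_getElem?_getD]
    rcases lt_or_ge i input.length with hi | hi
    · rw [List.getElem?_eq_getElem hi]
      exact hB _ (List.getElem_mem hi)
    · rw [List.getElem?_eq_none hi]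
      simp⟩
  exact ⟨τ, t, hr, ht.trans hT, hm⟩


/-- A straight-line sequence of programs. -/
def block : List RamProg → RamProg
  | [] => .skip
  | P :: Ps => .seq P (block Ps)

/-! ### Computing `⌊101 a n / (100 b)⌋ - 1` -/

/-- Program for `s(n)`: on input `[n, a, b]` it returns `101 * a * n / (100 * b) - 1`. -/
def orderProg : RamProg :=
  block [.load 2 1, .const 3 1, .load 4 3, .const 5 2, .load 6 5, .const 7 101, .arith .mul 4 4 7,
    .arith .mul 4 4 2, .const 7 100, .arith .mul 6 6 7, .arith .div 4 4 6, .arith .sub 4 4 3,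
    .store 1 4, .const 0 1]

theorem orderProg_computesWithin {n : ℕ} (hn : 1 ≤ n) (a b : ℕ) :
    orderProg.ComputesWithin [n, a, b] [101 * a * n / (100 * b) - 1]
      (420 * (n + a.size + b.size)) := by
  set L := n + a.size + b.size with hL
  have hn' : n < 2 ^ n := Nat.lt_two_pow_self
  have ha := Nat.lt_size_self a
  have hb := Nat.lt_size_self b
  have hbL : b ≤ 2 ^ L := hb.le.trans (Nat.pow_le_pow_right (by norm_num) (by omega))
  have haL : a ≤ 2 ^ L := ha.le.trans (Nat.pow_le_pow_right (by norm_num) (by omega))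
  have hnL : n ≤ 2 ^ L := hn'.le.trans (Nat.pow_le_pow_right (by norm_num) (by omega))
  have hanL : a * n ≤ 2 ^ L := by
    refine (Nat.mul_le_mul ha.le hn'.le).trans ?_
    rw [← pow_add]
    exact Nat.pow_le_pow_right (by norm_num) (by omega)
  have hL1 : 1 ≤ 2 ^ L := Nat.one_le_two_pow
  have hB : 2 ^ (L + 7) = 128 * 2 ^ L := by rw [pow_add]; ring
  have h101 : 101 * a * n = 101 * (a * n) := by ring
  have hdiv := Nat.div_le_self (101 * a * n) (100 * b)
  refine Halts.computesWithin (B := 2 ^ (L + 7)) (k := 15) ?_ ?_ ?_ ?_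
  · simp only [orderProg, block]
    refine .load n (by simp [RamState.init]) ?_
    refine .const (by omega) ?_
    refine .load a (by simp [RamState.init]) ?_
    refine .const (by omega) ?_
    refine .load b (by simp [RamState.init]) ?_
    refine .const (by omega) ?_
    refine .arith (101 * a) (by simp [RamOp.eval, mul_comm]) (by omega) ?_
    refine .arith (101 * a * n) (by simp [RamOp.eval]) (by omega) ?_
    refine .const (by omega) ?_
    refine .arith (100 * b) (by simp [RamOp.eval, mul_comm]) (by omega) ?_
    refine .arith (101 * a * n / (100 * b)) (by simp [RamOp.eval])
      (by omega) ?_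
    refine .arith (101 * a * n / (100 * b) - 1) (by simp [RamOp.eval])
      (by omega) ?_
    refine .store 0 (101 * a * n / (100 * b) - 1)
      (by simp [RamState.init]) (by simp) ?_
    refine .const (by omega) ?_
    refine .skip ?_
    simp [RamState.HasOutput, RamState.mem_setMem]
  · simp only [List.length_cons, List.length_nil]
    omega
  · intro x hx
    simp only [List.mem_cons, List.not_mem_nil, or_false] at hx
    omega
  · rw [Nat.size_pow]
    omega

/-! ### Finding a prime by trial division -/

/-- The least prime above `n ^ C`. -/
noncomputable def primeAbovePow (C n : ℕ) : ℕ := by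
  classical
  exact Nat.find (Nat.exists_infinite_primes (n ^ C + 1))

theorem primeAbovePow_prime (C n : ℕ) : (primeAbovePow C n).Prime :=
  (Nat.find_spec (Nat.exists_infinite_primes (n ^ C + 1))).2

theorem lt_primeAbovePow (C n : ℕ) : n ^ C < primeAbovePow C n :=
  (Nat.find_spec (Nat.exists_infinite_primes (n ^ C + 1))).1

theorem not_prime_of_lt_primeAbovePow {C n m : ℕ} (h1 : n ^ C < m) (h2 : m < primeAbovePow C n) :
    ¬ m.Prime := fun hm =>
  Nat.find_min (Nat.exists_infinite_primes (n ^ C + 1)) h2 ⟨h1, hm⟩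

theorem primeAbovePow_le {C n : ℕ} (hn : 1 ≤ n) : primeAbovePow C n ≤ 2 * n ^ C := by
  obtain ⟨p, hp, h1, h2⟩ := Nat.exists_prime_lt_and_le_two_mul (n ^ C) (by positivity)
  by_contra h
  exact not_prime_of_lt_primeAbovePow h1 (by omega) hp

/-- Adds to register `6` the number of divisors `d` of register `4` with `2 ≤ d ≤ r + 1`, where `r`
is the content of register `7`. Register `3` holds `1`; note that `1 - m % d` is `1` if `d ∣ m` and
`0` otherwise. -/
def divisorLoop : RamProg :=
  .loop 7 (block [.arith .add 8 7 3, .arith .mod 8 4 8, .arith .sub 8 3 8, .arith .add 6 6 8,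
    .arith .sub 7 7 3])

theorem halts_divisorLoop {B m : ℕ} {σ : RamState} (hm : 2 ≤ m) (hB : 2 * m ≤ B)
    (h3 : σ.reg 3 = 1) (h4 : σ.reg 4 = m) (h6 : σ.reg 6 = 0) (h7 : σ.reg 7 = m - 2) :
    Halts B divisorLoop σ ((m - 2) * 7 + 1) fun τ =>
      τ.mem = σ.mem ∧ (∀ r < 6, τ.reg r = σ.reg r) ∧ (τ.reg 6 ≠ 0 ↔ ¬ m.Prime) := by
  refine Halts.mono (Halts.loop (fun j τ => τ.mem = σ.mem ∧ (∀ r < 6, τ.reg r = σ.reg r) ∧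
      τ.reg 7 = j ∧ τ.reg 6 + j ≤ m ∧ (τ.reg 6 ≠ 0 ↔ ∃ d, d ∣ m ∧ j + 2 ≤ d ∧ d < m))
      (m - 2) ?_ ?_ ?_) le_rfl ?_
  · refine ⟨rfl, fun _ _ => rfl, h7, by omega, ?_⟩
    rw [h6]
    simp only [ne_eq, not_true_eq_false, false_iff, not_exists, not_and]
    intro d _ hd
    omega
  · rintro j hj τ ⟨hmem, hreg, hr7, hle, hiff⟩
    refine ⟨by omega, ?_⟩
    have h3' := (hreg 3 (by norm_num)).trans h3
    have h4' := (hreg 4 (by norm_num)).trans h4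
    have hmod := Nat.mod_le m (j + 2)
    simp only [block]
    refine .arith (j + 2) (by simp [RamOp.eval, h3', hr7]) (by omega) ?_
    refine .arith (m % (j + 2)) (by simp [RamOp.eval, h4']) (by omega) ?_
    refine .arith (1 - m % (j + 2)) (by simp [RamOp.eval, h3'])
      (by omega) ?_
    refine .arith (τ.reg 6 + (1 - m % (j + 2))) (by simp [RamOp.eval])
      (by omega) ?_
    refine .arith j (by simp [RamOp.eval, h3', hr7]) (by omega) ?_
    refine .skip ⟨hmem, fun r hr => ?_, by simp, ?_, ?_⟩
    · simp (disch := omega) only [RamState.reg_setReg_of_ne]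
      exact hreg r hr
    · simp
      omega
    · have : (τ.reg 6 + (1 - m % (j + 2)) ≠ 0) ↔ (τ.reg 6 ≠ 0 ∨ (j + 2) ∣ m) := by
        rw [Nat.dvd_iff_mod_eq_zero]
        omega
      rw [RamState.reg_setReg_of_ne _ (by norm_num), RamState.reg_setReg_self, this, hiff]
      constructor
      · rintro (⟨d, hd, h1, h2⟩ | h)
        · exact ⟨d, hd, by linarith, h2⟩
        · exact ⟨j + 2, h, le_rfl, Nat.lt_sub_iff_add_lt.1 hj⟩
      · rintro ⟨d, hd, h1, h2⟩
        rcases h1.eq_or_lt with h1 | h1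
        · exact Or.inr (h1 ▸ hd)
        · exact Or.inl ⟨d, hd, by omega, h2⟩
  · rintro τ ⟨-, -, h, -⟩
    exact h
  · rintro τ ⟨hmem, hreg, -, -, hiff⟩
    refine ⟨hmem, hreg, hiff.trans ?_⟩
    rw [Nat.not_prime_iff_exists_dvd_lt hm]

/-- Search for the least prime above `n ^ C`, on input `[n]`. -/
def primeProg (C : ℕ) : RamProg :=
  block [.load 2 1, .const 3 1, .const 4 1, .const 5 C,
    .loop 5 (block [.arith .mul 4 4 2, .arith .sub 5 5 3]),
    .const 6 1,
    .loop 6 (block [.arith .add 4 4 3, .arith .sub 7 4 3, .arith .sub 7 7 3, .const 6 0,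
      divisorLoop]),
    .store 1 4, .const 0 1]

theorem halts_primeProg {B C n : ℕ} (hn : 1 ≤ n) (hB : 2 * primeAbovePow C n + C + n + 1 ≤ B) :
    Halts B (primeProg C) (RamState.init [n]) (C * 4 + primeAbovePow C n * (7 * B + 7) + 10)
      fun τ => τ.HasOutput [primeAbovePow C n] := by
  set q := primeAbovePow C n with hq
  have hqn : n ^ C < q := lt_primeAbovePow C n
  have hpos : 1 ≤ n ^ C := Nat.one_le_pow _ _ hn
  refine Halts.mono (k := ((((q - n ^ C) * ((7 * B + 1 + 1 + 4) + 1) + 1) + 3) + 1 +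
    (C * (3 + 1) + 1)) + 4) ?_ ?_ (fun _ h => h)
  · simp only [primeProg, block]
    refine .load n (by simp [RamState.init]) ?_
    refine .const (by omega) ?_
    refine .const (by omega) ?_
    refine .const (by omega) ?_
    rw [add_comm _ (C * (3 + 1) + 1)]
    refine Halts.seq (mid := fun τ => τ.reg 1 = 0 ∧ τ.reg 3 = 1 ∧ τ.reg 4 = n ^ C) ?_ ?_
    · refine Halts.mono (Halts.loop (fun j τ => j ≤ C ∧ τ.reg 1 = 0 ∧ τ.reg 2 = n ∧ τ.reg 3 = 1 ∧
        τ.reg 4 = n ^ (C - j) ∧ τ.reg 5 = j) C ?_ ?_ ?_) le_rfl ?_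
      · simp [RamState.init]
      · rintro j hj τ ⟨-, h1, h2, h3, h4, h5⟩
        refine ⟨by omega, ?_⟩
        have hpow : n ^ (C - (j + 1)) * n = n ^ (C - j) := by
          rw [← pow_succ]
          congr 1
          omega
        have hle : n ^ (C - j) ≤ n ^ C := Nat.pow_le_pow_right hn (Nat.sub_le _ _)
        refine .arith (n ^ (C - j)) (by rw [h4, h2]; exact hpow) (by omega) ?_
        refine .arith j (by simp [RamOp.eval, h5, h3]) (by omega) ?_
        exact .skip ⟨by omega, by simp [h1],
          by simp [h2], by simp [h3],
          by simp, by simp⟩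
      · rintro τ ⟨-, -, -, -, -, h⟩
        exact h
      · rintro τ ⟨-, h1, -, h3, h4, -⟩
        exact ⟨h1, h3, by simpa using h4⟩
    · rintro τ ⟨h1, h3, h4⟩
      refine .const (by omega) ?_
      refine Halts.seq (k := (q - n ^ C) * ((7 * B + 1 + 1 + 4) + 1) + 1) (l := 3)
        (mid := fun τ => τ.reg 1 = 0 ∧ τ.reg 4 = q) ?_ ?_
      · refine Halts.mono (Halts.loop (k := 7 * B + 1 + 1 + 4) (fun j τ => j ≤ q - n ^ C ∧
          τ.reg 1 = 0 ∧ τ.reg 3 = 1 ∧ τ.reg 4 = q - j ∧ (τ.reg 6 ≠ 0 ↔ j ≠ 0)) (q - n ^ C)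
          ?_ ?_ ?_) le_rfl ?_
        · refine ⟨le_rfl, by simp [h1], by simp [h3], ?_, ?_⟩
          · rw [RamState.reg_setReg_of_ne _ (by norm_num), h4]
            omega
          · rw [RamState.reg_setReg_self]
            omega
        · rintro j hj τ ⟨-, h1, h3, h4, h6⟩
          refine ⟨by omega, ?_⟩
          refine .arith (q - j) (by simp [RamOp.eval, h3, h4]; omega) (by omega) ?_
          refine .arith (q - j - 1) (by simp [RamOp.eval, h3]) (by omega) ?_
          refine .arith (q - j - 2) (by simp [RamOp.eval, h3]; omega)
            (by omega) ?_
          refine .const (by omega) ?_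
          refine Halts.seq (k := 7 * B + 1) (l := 1) (Halts.mono
            (halts_divisorLoop (m := q - j) (by omega) (by omega)
            (by simp [h3]) (by simp)
            (by simp) (by simp)) ?_ fun _ h => h) ?_
          · omega
          · rintro υ ⟨hmem, hreg, hiff⟩
            refine .skip ?_
            refine ⟨by omega, ?_, ?_, ?_, ?_⟩
            · rw [hreg 1 (by norm_num)]
              simp [h1]
            · rw [hreg 3 (by norm_num)]
              simp [h3]
            · rw [hreg 4 (by norm_num)]
              simp
            · rw [hiff]
              constructor
              · rintro h rfl
                exact h (primeAbovePow_prime C n)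
              · intro h
                exact not_prime_of_lt_primeAbovePow (C := C) (n := n) (by omega) (by omega)
        · rintro τ ⟨-, -, -, -, h⟩
          by_contra h'
          exact h.1 h' rfl
        · rintro τ ⟨-, h1, -, h4, -⟩
          exact ⟨h1, by simpa using h4⟩
      · rintro τ ⟨h1, h4⟩
        refine .store 0 q h1 h4 ?_
        refine .const (by omega) ?_
        refine .skip ?_
        simp [RamState.HasOutput, RamState.mem_setMem]
  · have : (q - n ^ C) * (7 * B + 1 + 1 + 4 + 1) ≤ q * (7 * B + 7) :=
      Nat.mul_le_mul (Nat.sub_le _ _) (by omega)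
    omega

end RamProg

/-! ### Polynomial arithmetic in memory -/

namespace RamProg

/-- The first `n` coefficients of `p`, as numbers below `q`, stand in memory from cell `W` on. -/
def Stores {q : ℕ} (σ : RamState) (W n : ℕ) (p : (ZMod q)[X]) : Prop :=
  ∀ i < n, σ.mem (W + i) = (p.coeff i).val

/-- Registers below `20` and memory outside the `n` cells from `W` on agree in `σ` and `τ`. -/
def Frame (σ τ : RamState) (W n : ℕ) : Prop :=
  (∀ r < 20, τ.reg r = σ.reg r) ∧ ∀ i, i < W ∨ W + n ≤ i → τ.mem i = σ.mem i

theorem mod_eq_val {q N : ℕ} {u : ZMod q} (h : (N : ZMod q) = u) : N % q = u.val := by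
  rw [← h, ZMod.val_natCast]

/-- Copies as many cells as register `22` says, from the address in register `20` to the address
in register `21`. -/
def copyLoop : RamProg :=
  .loop 22 (block [.load 25 20, .store 21 25, .arith .add 20 20 6, .arith .add 21 21 6,
    .arith .sub 22 22 6])

theorem halts_copyLoop {B W V n : ℕ} {σ : RamState} (h6 : σ.reg 6 = 1) (h20 : σ.reg 20 = V)
    (h21 : σ.reg 21 = W) (h22 : σ.reg 22 = n) (hVW : V + n ≤ W) (hB : W + n ≤ B) :
    Halts B copyLoop σ (n * 7 + 1) fun τ =>
      Frame σ τ W n ∧ ∀ i < n, τ.mem (W + i) = σ.mem (V + i) := by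
  refine Halts.mono (Halts.loop (fun j τ => j ≤ n ∧ Frame σ τ W n ∧
      (∀ i < n - j, τ.mem (W + i) = σ.mem (V + i)) ∧ τ.reg 20 = V + (n - j) ∧
      τ.reg 21 = W + (n - j) ∧ τ.reg 22 = j) n ?_ ?_ ?_) le_rfl ?_
  · exact ⟨le_rfl, ⟨fun _ _ => rfl, fun _ _ => rfl⟩, fun i hi => by omega, by omega, by omega, h22⟩
  · rintro j hj τ ⟨-, ⟨hreg, hmem⟩, hst, hr20, hr21, hr22⟩
    have h6' := (hreg 6 (by norm_num)).trans h6
    refine ⟨by omega, ?_⟩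
    refine .load (σ.mem (V + (n - (j + 1)))) (by rw [hr20]; exact hmem _ (by omega)) ?_
    refine .store (W + (n - (j + 1))) (σ.mem (V + (n - (j + 1)))) (by simp [hr21]) (by simp) ?_
    refine .arith (V + (n - j)) (by simp [RamOp.eval, hr20, h6']; omega) (by omega) ?_
    refine .arith (W + (n - j)) (by simp [RamOp.eval, hr21, h6']; omega) (by omega) ?_
    refine .arith j (by simp [RamOp.eval, hr22, h6']) (by omega) ?_
    refine .skip ⟨hj.le, ⟨fun r hr => ?_, fun i hi => ?_⟩, fun i hi => ?_, by simp, by simp,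
      by simp⟩
    · simp (disch := omega) only [RamState.reg_setReg_of_ne, RamState.reg_setMem]
      exact hreg r hr
    · simp only [RamState.mem_setReg, RamState.mem_setMem]
      rw [if_neg (by omega)]
      exact hmem i hi
    · simp only [RamState.mem_setReg, RamState.mem_setMem]
      split_ifs with h
      · congr 1
        omega
      · exact hst i (by omega)
  · rintro τ ⟨-, -, -, -, -, h⟩
    exact h
  · rintro τ ⟨-, hf, hst, -⟩
    exact ⟨hf, by simpa using hst⟩

/-- Multiplies in place the polynomial of `n` coefficients whose address is in register `20` by
`X + m`, where register `14` holds `m`; register `24` carries the preceding old coefficient. -/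
def mulLoop : RamProg :=
  .loop 22 (block [.load 25 20, .arith .mul 26 25 14, .arith .add 26 26 24, .arith .mod 26 26 1,
    .store 20 26, .arith .add 24 25 7, .arith .add 20 20 6, .arith .sub 22 22 6])

theorem halts_mulLoop {q B W n m : ℕ} [NeZero q] {σ : RamState} {p : (ZMod q)[X]} {y : ZMod q}
    (h1 : σ.reg 1 = q) (h6 : σ.reg 6 = 1) (h7 : σ.reg 7 = 0) (h14 : σ.reg 14 = m)
    (h20 : σ.reg 20 = W) (h22 : σ.reg 22 = n) (h24 : σ.reg 24 = 0) (hp : Stores σ W n p)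
    (hm : m ≤ q) (hmy : (m : ZMod q) = -y) (hB : W + n ≤ B) (hqB : q * q + q ≤ B) :
    Halts B mulLoop σ (n * 10 + 1) fun τ => Frame σ τ W n ∧ Stores τ W n ((X - C y) * p) := by
  refine Halts.mono (Halts.loop (fun j τ => j ≤ n ∧ Frame σ τ W n ∧
      (∀ i < n - j, τ.mem (W + i) = (((X - C y) * p).coeff i).val) ∧
      (∀ i, n - j ≤ i → i < n → τ.mem (W + i) = (p.coeff i).val) ∧
      τ.reg 20 = W + (n - j) ∧ τ.reg 22 = j ∧ τ.reg 24 = ((X * p).coeff (n - j)).val)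
      n ?_ ?_ ?_) le_rfl ?_
  · exact ⟨le_rfl, ⟨fun _ _ => rfl, fun _ _ => rfl⟩, fun i hi => by omega,
      fun i _ hi => hp i hi, by omega, h22, by simp [h24]⟩
  · rintro j hj τ ⟨-, ⟨hreg, hmem⟩, hnew, hold, hr20, hr22, hr24⟩
    have h1' := (hreg 1 (by norm_num)).trans h1
    have h6' := (hreg 6 (by norm_num)).trans h6
    have h7' := (hreg 7 (by norm_num)).trans h7
    have h14' := (hreg 14 (by norm_num)).trans h14
    obtain ⟨i, hi⟩ : ∃ i, i = n - (j + 1) := ⟨_, rfl⟩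
    have hi' : n - j = i + 1 := by omega
    rw [← hi] at hnew hold hr20 hr24
    have hlt := ZMod.val_lt (p.coeff i)
    have hlt' := ZMod.val_lt ((X * p).coeff i)
    have hprod : (p.coeff i).val * m ≤ q * q := Nat.mul_le_mul hlt.le hm
    have hval : ((p.coeff i).val * m + ((X * p).coeff i).val) % q =
        (((X - C y) * p).coeff i).val := by
      refine mod_eq_val ?_
      rw [Nat.cast_add, Nat.cast_mul, ZMod.natCast_zmod_val, ZMod.natCast_zmod_val, hmy, sub_mul,
        coeff_sub, coeff_C_mul]
      ring
    have hlt'' := ZMod.val_lt (((X - C y) * p).coeff i)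
    refine ⟨by omega, ?_⟩
    refine .load (p.coeff i).val (by rw [hr20]; exact hold i le_rfl (by omega)) ?_
    refine .arith ((p.coeff i).val * m) (by simp [RamOp.eval, h14']) (by omega) ?_
    refine .arith ((p.coeff i).val * m + ((X * p).coeff i).val) (by simp [RamOp.eval, hr24])
      (by omega) ?_
    refine .arith (((X - C y) * p).coeff i).val (by
      rw [← hval]
      simp only [RamOp.eval, RamState.reg_setReg_self]
      simp [h1']) (by omega) ?_
    refine .store (W + i) (((X - C y) * p).coeff i).val (by simp [hr20]) (by simp) ?_
    refine .arith (p.coeff i).val (by simp [RamOp.eval, h7']) (by omega) ?_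
    refine .arith (W + (i + 1)) (by simp [RamOp.eval, hr20, h6', add_assoc]) (by omega) ?_
    refine .arith j (by simp [RamOp.eval, hr22, h6']) (by omega) ?_
    refine .skip ?_
    rw [hi']
    refine ⟨hj.le, ⟨fun r hr => ?_, fun k hk => ?_⟩, fun k hk => ?_, fun k hk hkn => ?_,
      by simp, by simp, by simp [coeff_X_mul]⟩
    · simp (disch := omega) only [RamState.reg_setReg_of_ne, RamState.reg_setMem]
      exact hreg r hr
    · simp only [RamState.mem_setReg, RamState.mem_setMem]
      rw [if_neg (by omega)]
      exact hmem k hk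
    · simp only [RamState.mem_setReg, RamState.mem_setMem]
      split_ifs with h
      · rw [show k = i by omega]
      · exact hnew k (by omega)
    · simp only [RamState.mem_setReg, RamState.mem_setMem]
      rw [if_neg (by omega)]
      exact hold k (by omega) hkn
  · rintro τ ⟨-, -, -, -, -, h, -⟩
    exact h
  · rintro τ ⟨-, hf, hst, -⟩
    exact ⟨hf, by simpa [Stores] using hst⟩

/-- Horner's scheme, from the top: divides in place the polynomial of `n` coefficients that ends
before the address in register `20` by `X - x`, where register `11` holds `x`. Register `24`
carries the next coefficient of the quotient, and finally the remainder. -/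
def divLoop : RamProg :=
  .loop 22 (block [.arith .sub 20 20 6, .load 25 20, .store 20 24, .arith .mul 24 24 11,
    .arith .add 24 24 25, .arith .mod 24 24 1, .arith .sub 22 22 6])

theorem halts_divLoop {q B W n m : ℕ} [Fact q.Prime] {σ : RamState} {p : (ZMod q)[X]}
    {x : ZMod q} (h1 : σ.reg 1 = q) (h6 : σ.reg 6 = 1) (h11 : σ.reg 11 = m)
    (h20 : σ.reg 20 = W + n) (h22 : σ.reg 22 = n) (h24 : σ.reg 24 = 0) (hp : Stores σ W n p)
    (hpd : p.degree < n) (hm : m ≤ q) (hmx : (m : ZMod q) = x) (hB : W + n ≤ B)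
    (hqB : q * q + q ≤ B) :
    Halts B divLoop σ (n * 9 + 1) fun τ =>
      Frame σ τ W n ∧ Stores τ W n (p /ₘ (X - C x)) ∧ τ.reg 24 = (p.eval x).val := by
  set e := p /ₘ (X - C x) with he
  -- The values of the carry are the coefficients of `E`.
  set E : (ZMod q)[X] := C (p.eval x) + X * e with hE
  have hEcoeff : ∀ i, E.coeff i = p.coeff i + x * e.coeff i := by
    intro i
    have h := p.modByMonic_add_div (X - C x)
    rw [modByMonic_X_sub_C_eq_C_eval, ← he, sub_mul] at h
    rw [← coeff_C_mul, ← coeff_add]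
    congr 1
    rw [hE]
    linear_combination h
  have hE0 : E.coeff n = 0 := by
    rw [hEcoeff, coeff_eq_zero_of_degree_lt hpd,
      coeff_eq_zero_of_degree_lt ((degree_divByMonic_le _ _).trans_lt hpd), mul_zero, add_zero]
  refine Halts.mono (Halts.loop (fun j τ => Frame σ τ W n ∧
      (∀ i < j, τ.mem (W + i) = (p.coeff i).val) ∧
      (∀ i, j ≤ i → i < n → τ.mem (W + i) = (e.coeff i).val) ∧
      τ.reg 20 = W + j ∧ τ.reg 22 = j ∧ τ.reg 24 = (E.coeff j).val)
      n ?_ ?_ ?_) le_rfl ?_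
  · exact ⟨⟨fun _ _ => rfl, fun _ _ => rfl⟩, hp, fun i hi hi' => by omega, h20, h22,
      by rw [hE0, ZMod.val_zero, h24]⟩
  · rintro j hj τ ⟨⟨hreg, hmem⟩, hold, hnew, hr20, hr22, hr24⟩
    have h1' := (hreg 1 (by norm_num)).trans h1
    have h6' := (hreg 6 (by norm_num)).trans h6
    have h11' := (hreg 11 (by norm_num)).trans h11
    have hEe : E.coeff (j + 1) = e.coeff j := by
      rw [hE, coeff_add, coeff_C_succ, coeff_X_mul, zero_add]
    rw [hEe] at hr24
    have hlt := ZMod.val_lt (p.coeff j)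
    have hlt' := ZMod.val_lt (e.coeff j)
    have hprod : (e.coeff j).val * m ≤ q * q := Nat.mul_le_mul hlt'.le hm
    have hval : ((e.coeff j).val * m + (p.coeff j).val) % q = (E.coeff j).val := by
      refine mod_eq_val ?_
      rw [Nat.cast_add, Nat.cast_mul, ZMod.natCast_zmod_val, ZMod.natCast_zmod_val, hmx, hEcoeff]
      ring
    have hlt'' := ZMod.val_lt (E.coeff j)
    refine ⟨by omega, ?_⟩
    refine .arith (W + j) (by simp [RamOp.eval, hr20, h6']) (by omega) ?_
    refine .load (p.coeff j).val (by simp [hold j (Nat.lt_succ_self j)]) ?_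
    refine .store (W + j) (e.coeff j).val (by simp) (by simp [hr24]) ?_
    refine .arith ((e.coeff j).val * m) (by simp [RamOp.eval, hr24, h11']) (by omega) ?_
    refine .arith ((e.coeff j).val * m + (p.coeff j).val) (by simp [RamOp.eval]) (by omega) ?_
    refine .arith (E.coeff j).val (by
      rw [← hval]
      simp only [RamOp.eval, RamState.reg_setReg_self]
      simp [h1']) (by omega) ?_
    refine .arith j (by simp [RamOp.eval, hr22, h6']) (by omega) ?_
    refine .skip ⟨⟨fun r hr => ?_, fun k hk => ?_⟩, fun k hk => ?_, fun k hk hkn => ?_,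
      by simp, by simp, by simp⟩
    · simp (disch := omega) only [RamState.reg_setReg_of_ne, RamState.reg_setMem]
      exact hreg r hr
    · simp only [RamState.mem_setReg, RamState.mem_setMem]
      rw [if_neg (by omega)]
      exact hmem k hk
    · simp only [RamState.mem_setReg, RamState.mem_setMem]
      rw [if_neg (by omega)]
      exact hold k (by omega)
    · simp only [RamState.mem_setReg, RamState.mem_setMem]
      split_ifs with h
      · rw [show k = j by omega]
      · exact hnew k (by omega) hkn
  · rintro τ ⟨-, -, -, -, h, -⟩
    exact h
  · rintro τ ⟨hf, -, hst, -, -, h⟩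
    refine ⟨hf, fun i hi => hst i (Nat.zero_le i) hi, ?_⟩
    rw [h]
    simp [hE]

/-- Adds modulo `q` the vectors of length `n` at the addresses in registers `20` and `21` and
writes the sum from the address in register `23` on. -/
def addLoop : RamProg :=
  .loop 22 (block [.load 24 20, .load 25 21, .arith .add 24 24 25, .arith .mod 24 24 1,
    .store 23 24, .arith .add 20 20 6, .arith .add 21 21 6, .arith .add 23 23 6,
    .arith .sub 22 22 6])

theorem halts_addLoop {q B U V W n : ℕ} [NeZero q] {σ : RamState} {f g : (ZMod q)[X]}
    (h1 : σ.reg 1 = q) (h6 : σ.reg 6 = 1) (h20 : σ.reg 20 = U) (h21 : σ.reg 21 = V)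
    (h22 : σ.reg 22 = n) (h23 : σ.reg 23 = W) (hf : Stores σ U n f) (hg : Stores σ V n g)
    (hWU : W ≤ U) (hUV : U + n ≤ V) (hB : V + n ≤ B) (hqB : q + q ≤ B) :
    Halts B addLoop σ (n * 11 + 1) fun τ => Frame σ τ W n ∧ Stores τ W n (f + g) := by
  refine Halts.mono (Halts.loop (fun j τ => j ≤ n ∧ (∀ r < 20, τ.reg r = σ.reg r) ∧
      (∀ i, i < W ∨ W + (n - j) ≤ i → τ.mem i = σ.mem i) ∧
      (∀ i < n - j, τ.mem (W + i) = ((f + g).coeff i).val) ∧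
      τ.reg 20 = U + (n - j) ∧ τ.reg 21 = V + (n - j) ∧ τ.reg 23 = W + (n - j) ∧ τ.reg 22 = j)
      n ?_ ?_ ?_) le_rfl ?_
  · exact ⟨le_rfl, fun _ _ => rfl, fun _ _ => rfl, fun i hi => by omega, by omega, by omega,
      by omega, h22⟩
  · rintro j hj τ ⟨-, hreg, hmem, hst, hr20, hr21, hr23, hr22⟩
    have h1' := (hreg 1 (by norm_num)).trans h1
    have h6' := (hreg 6 (by norm_num)).trans h6
    obtain ⟨i, hi⟩ : ∃ i, i = n - (j + 1) := ⟨_, rfl⟩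
    have hi' : n - j = i + 1 := by omega
    rw [← hi] at hst hr20 hr21 hr23 hmem
    have hlt := ZMod.val_lt (f.coeff i)
    have hlt' := ZMod.val_lt (g.coeff i)
    have hval : ((f.coeff i).val + (g.coeff i).val) % q = ((f + g).coeff i).val := by
      rw [coeff_add, ZMod.val_add]
    have hlt'' := ZMod.val_lt ((f + g).coeff i)
    refine ⟨by omega, ?_⟩
    refine .load (f.coeff i).val (by
      rw [hr20, hmem _ (by omega)]; exact hf i (by omega)) ?_
    refine .load (g.coeff i).val (by
      simp only [ne_eq, Nat.reduceEqDiff, not_false_eq_true, RamState.reg_setReg_of_ne,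
        RamState.mem_setReg]
      rw [hr21, hmem _ (by omega)]; exact hg i (by omega)) ?_
    refine .arith ((f.coeff i).val + (g.coeff i).val) (by simp [RamOp.eval]) (by omega) ?_
    refine .arith ((f + g).coeff i).val (by
      rw [← hval]
      simp only [RamOp.eval, RamState.reg_setReg_self]
      simp [h1']) (by omega) ?_
    refine .store (W + i) ((f + g).coeff i).val (by simp [hr23]) (by simp) ?_
    refine .arith (U + (i + 1)) (by simp [RamOp.eval, hr20, h6', add_assoc]) (by omega) ?_
    refine .arith (V + (i + 1)) (by simp [RamOp.eval, hr21, h6', add_assoc]) (by omega) ?_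
    refine .arith (W + (i + 1)) (by simp [RamOp.eval, hr23, h6', add_assoc]) (by omega) ?_
    refine .arith j (by simp [RamOp.eval, hr22, h6']) (by omega) ?_
    refine .skip ?_
    rw [hi']
    refine ⟨hj.le, fun r hr => ?_, fun k hk => ?_, fun k hk => ?_, by simp, by simp, by simp,
      by simp⟩
    · simp (disch := omega) only [RamState.reg_setReg_of_ne, RamState.reg_setMem]
      exact hreg r hr
    · simp only [RamState.mem_setReg, RamState.mem_setMem]
      rw [if_neg (by omega)]
      exact hmem k (by omega)
    · simp only [RamState.mem_setReg, RamState.mem_setMem]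
      split_ifs with h
      · rw [show k = i by omega]
      · exact hst k (by omega)
  · rintro τ ⟨-, -, -, -, -, -, -, h⟩
    exact h
  · rintro τ ⟨-, hr, hm, hst, -⟩
    exact ⟨⟨hr, by simpa using hm⟩, by simpa [Stores] using hst⟩


/-! ### The neighbour function and its program -/

/-- Some `(X - x)^(s+1)` with a natural number `x < k` divides `p`. -/
def HasPowerFactorBelow {q : ℕ} (s k : ℕ) (p : (ZMod q)[X]) : Prop :=
  ∃ x < k, (X - C (x : ZMod q)) ^ (s + 1) ∣ p

/-- The `(y, t)`-th neighbour `f + (X - y)^(s+1) t` of `f`. Since a neighbour may arise from several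
`y`, the index is used only if no smaller `y` gives the same neighbour. -/
noncomputable def ktNeighbor {q n : ℕ} [Fact q.Prime] (s : ℕ) (f : Fin n → ZMod q)
    (i : ZMod q × (Fin (n - (s + 1)) → ZMod q)) : Option (Fin n → ZMod q) := by
  classical
  exact if HasPowerFactorBelow s i.1.val ((X - C i.1) ^ (s + 1) * vecPoly i.2)
    then none else some (f + mulVec n ((X - C i.1) ^ (s + 1)) i.2)

theorem isNeighborFunction_ktNeighbor {q n s : ℕ} [Fact q.Prime]
    (hs : ∀ k ≤ s, k ≠ 0 → (k : ZMod q) ≠ 0) :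
    (ktHalf (ZMod q) n s).IsNeighborFunction (ktNeighbor s) := by
  classical
  have hvec : ∀ (y : ZMod q) (t : Fin (n - (s + 1)) → ZMod q),
      vecPoly (mulVec n ((X - C y) ^ (s + 1)) t) = (X - C y) ^ (s + 1) * vecPoly t :=
    fun y t => vecPoly_mulVec (by rw [natDegree_X_sub_C_pow]) t
  constructor
  · rintro f ⟨y, t⟩ g h
    simp only [ktNeighbor] at h
    split_ifs at h
    obtain rfl := Option.some.inj h
    rw [ktHalf_adj_iff hs]
    refine ⟨y, ?_⟩
    rw [vecPoly_add, hvec, add_sub_cancel_left]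
    exact dvd_mul_right _ _
  · intro f g hfg
    rw [ktHalf_adj_iff hs] at hfg
    obtain ⟨y₀, hy₀⟩ := hfg
    have hex : ∃ x : ℕ, (X - C (x : ZMod q)) ^ (s + 1) ∣ vecPoly g - vecPoly f :=
      ⟨y₀.val, by rwa [ZMod.natCast_zmod_val]⟩
    obtain ⟨x, hx⟩ : ∃ x, x = Nat.find hex := ⟨_, rfl⟩
    have hxd : (X - C (x : ZMod q)) ^ (s + 1) ∣ vecPoly g - vecPoly f := hx ▸ Nat.find_spec hex
    have hxmin : ∀ z < x, ¬ (X - C (z : ZMod q)) ^ (s + 1) ∣ vecPoly g - vecPoly f :=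
      fun z hz => Nat.find_min hex (hx ▸ hz)
    have hxq : x < q := by
      refine lt_of_le_of_lt ?_ (ZMod.val_lt y₀)
      rw [hx]
      exact Nat.find_min' hex (by rwa [ZMod.natCast_zmod_val])
    have hxval : ((x : ZMod q)).val = x := ZMod.val_natCast_of_lt hxq
    obtain ⟨t, ht⟩ : ∃ t : Fin (n - (s + 1)) → ZMod q,
        mulVec n ((X - C (x : ZMod q)) ^ (s + 1)) t = g - f := by
      rw [← vecPoly_sub, dvd_vecPoly_iff (X_sub_C_pow_ne_zero _ _)] at hxd
      rwa [natDegree_X_sub_C_pow] at hxd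
    refine ⟨(x, t), ?_, ?_⟩
    · simp only [ktNeighbor]
      rw [← hvec, ht, vecPoly_sub, if_neg, add_sub_cancel]
      rintro ⟨z, hz, hzd⟩
      exact hxmin z (hxval ▸ hz) hzd
    · rintro ⟨y, u⟩ h
      simp only [ktNeighbor] at h
      split_ifs at h with hno
      have hgf : mulVec n ((X - C y) ^ (s + 1)) u = g - f := by
        rw [← Option.some.inj h, add_sub_cancel_left]
      rw [← hvec, hgf, vecPoly_sub] at hno
      simp only [HasPowerFactorBelow, not_exists, not_and] at hno
      have hyd : (X - C y) ^ (s + 1) ∣ vecPoly g - vecPoly f := by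
        rw [← vecPoly_sub, ← hgf, hvec]
        exact dvd_mul_right _ _
      have hyx : y = x := by
        rw [← ZMod.natCast_zmod_val y] at hyd ⊢
        congr 1
        refine le_antisymm (not_lt.1 fun hlt => hno x hlt hxd) (not_lt.1 fun hlt => hxmin _ hlt hyd)
      subst hyx
      congr 1
      exact mulVec_injective (by rw [natDegree_X_sub_C_pow]) (X_sub_C_pow_ne_zero _ _)
        (hgf.trans ht.symm)

/-- The constants that the main loops of `neighborProg` keep in the registers, and the vector `f` in
its place in the input. Registers `5` and `8` hold the addresses of two work areas. -/
structure Env {q n : ℕ} (s : ℕ) (f : Fin n → ZMod q) (y : ZMod q) (σ : RamState) : Prop where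
  reg1 : σ.reg 1 = q
  reg2 : σ.reg 2 = n
  reg3 : σ.reg 3 = s + 1
  reg4 : σ.reg 4 = y.val
  reg5 : σ.reg 5 = 2 * n + 4
  reg6 : σ.reg 6 = 1
  reg7 : σ.reg 7 = 0
  reg8 : σ.reg 8 = 3 * n + 4
  reg14 : σ.reg 14 = q - y.val
  stores : Stores σ 3 n (vecPoly f)

variable {q n s B : ℕ} {f : Fin n → ZMod q} {y : ZMod q} {σ τ : RamState}

theorem Env.setReg (h : Env s f y σ) {d v : ℕ} (hd : 14 < d ∨ (9 ≤ d ∧ d ≤ 13)) :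
    Env s f y (σ.setReg d v) := by
  obtain ⟨h1, h2, h3, h4, h5, h6, h7, h8, h14, hf⟩ := h
  constructor <;> first
    | (rw [RamState.reg_setReg_of_ne _ (by omega)]; assumption)
    | exact hf

theorem Env.frame (h : Env s f y σ) {W : ℕ} (hF : Frame σ τ W n) (hW : 2 * n + 4 ≤ W) :
    Env s f y τ := by
  obtain ⟨h1, h2, h3, h4, h5, h6, h7, h8, h14, hf⟩ := h
  obtain ⟨hr, hm⟩ := hF
  constructor <;> first
    | (rw [hr _ (by norm_num)]; assumption)
    | exact fun i hi => (hm _ (by omega)).trans (hf i hi)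

/-- Reads the input and places the polynomial `t` into the first work area. -/
def setupProg : RamProg :=
  block [.const 6 1, .load 1 7, .load 2 6, .const 20 2, .load 3 20, .arith .add 3 3 6, .const 20 3,
    .arith .add 20 20 2, .load 4 20, .arith .add 20 20 6, .const 5 4, .arith .add 5 5 2,
    .arith .add 5 5 2, .arith .add 8 5 2, .arith .sub 14 1 4, .arith .add 21 5 7,
    .arith .sub 22 2 3, copyLoop]

theorem halts_setupProg [Fact q.Prime] (hs : s + 1 ≤ n) (t : Fin (n - (s + 1)) → ZMod q)
    (hB : 4 * n + 8 ≤ B) (hqB : q ≤ B) :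
    Halts B setupProg
      (RamState.init ([q, n, s] ++ encodeVec f ++ [y.val] ++ encodeVec t)) (n * 7 + 20)
      fun τ => Env s f y τ ∧ Stores τ (2 * n + 4) n (vecPoly t) := by
  set σ := RamState.init ([q, n, s] ++ encodeVec f ++ [y.val] ++ encodeVec t) with hσ
  have hmem : ∀ i, σ.mem i = ([q, n, s] ++ encodeVec f ++ [y.val] ++ encodeVec t).getD i 0 :=
    fun _ => rfl
  have hlf : (encodeVec f).length = n := by simp [encodeVec]
  have hlt : (encodeVec t).length = n - (s + 1) := by simp [encodeVec]
  have hm0 : σ.mem 0 = q := by simp [hmem]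
  have hm1 : σ.mem 1 = n := by simp [hmem]
  have hm2 : σ.mem 2 = s := by simp [hmem]
  have hmf : ∀ i < n, σ.mem (3 + i) = ((vecPoly f).coeff i).val := by
    intro i hi
    rw [hmem, coeff_vecPoly, dif_pos hi, List.getD_eq_getElem?_getD, List.append_assoc,
      List.append_assoc, List.getElem?_append_right (by simp),
      List.getElem?_append_left (by simp [hlf]; omega)]
    simp [encodeVec, hi]
  have hmy : σ.mem (3 + n) = y.val := by
    rw [hmem, List.getD_eq_getElem?_getD, List.append_assoc,
      List.getElem?_append_right (by simp [hlf]; omega)]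
    simp [hlf, show 3 + n - (n + 1 + 1 + 1) = 0 by omega]
  have hmt : ∀ i < n - (s + 1), σ.mem (4 + n + i) = ((vecPoly t).coeff i).val := by
    intro i hi
    rw [hmem, coeff_vecPoly, dif_pos hi, List.getD_eq_getElem?_getD,
      List.getElem?_append_right (by simp [hlf]; omega)]
    have : 4 + n + i - ([q, n, s] ++ encodeVec f ++ [y.val]).length = i := by
      simp [hlf]
      omega
    rw [this]
    simp [encodeVec, hi]
  have hmz : ∀ i, 2 * n + 4 ≤ i → σ.mem i = 0 := by
    intro i hi
    rw [hmem, List.getD_eq_getElem?_getD, List.getElem?_eq_none]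
    · rfl
    · simp [hlf, hlt]
      omega
  have hy := ZMod.val_lt y
  have hreg : ∀ r, r ≠ 0 → σ.reg r = 0 := fun r hr => by simp [hσ, RamState.init, hr]
  have hr7 := hreg 7 (by norm_num)
  refine Halts.mono (k := (n - (s + 1)) * 7 + 1 + 1 + 17) ?_ (by omega) fun _ h => h
  refine .const (by omega) ?_
  refine .load q (by simp [hr7, hm0]) ?_
  refine .load n (by simp [hm1]) ?_
  refine .const (by omega) ?_
  refine .load s (by simp [hm2]) ?_
  refine .arith (s + 1) (by simp [RamOp.eval]) (by omega) ?_
  refine .const (by omega) ?_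
  refine .arith (3 + n) (by simp [RamOp.eval]) (by omega) ?_
  refine .load y.val (by simp [hmy]) ?_
  refine .arith (4 + n) (by simp [RamOp.eval]; omega) (by omega) ?_
  refine .const (by omega) ?_
  refine .arith (4 + n) (by simp [RamOp.eval]) (by omega) ?_
  refine .arith (2 * n + 4) (by simp [RamOp.eval]; omega) (by omega) ?_
  refine .arith (3 * n + 4) (by simp [RamOp.eval]; omega) (by omega) ?_
  refine .arith (q - y.val) (by simp [RamOp.eval]) (by omega) ?_
  refine .arith (2 * n + 4) (by simp [RamOp.eval, hr7]) (by omega) ?_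
  refine .arith (n - (s + 1)) (by simp [RamOp.eval]) (by omega) ?_
  refine Halts.seq (k := (n - (s + 1)) * 7 + 1) (l := 1)
    (halts_copyLoop (V := 4 + n) (W := 2 * n + 4) (n := n - (s + 1))
    (by simp) (by simp) (by simp) (by simp) (by omega) (by omega)) ?_
  rintro τ ⟨⟨hr, hm⟩, hst⟩
  refine .skip ⟨⟨?_, ?_, ?_, ?_, ?_, ?_, ?_, ?_, ?_, ?_⟩, ?_⟩
  · rw [hr _ (by norm_num)]; simp
  · rw [hr _ (by norm_num)]; simp
  · rw [hr _ (by norm_num)]; simp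
  · rw [hr _ (by norm_num)]; simp
  · rw [hr _ (by norm_num)]; simp
  · rw [hr _ (by norm_num)]; simp
  · rw [hr _ (by norm_num)]; simp [hr7]
  · rw [hr _ (by norm_num)]; simp
  · rw [hr _ (by norm_num)]; simp
  · intro i hi
    rw [hm _ (by omega)]
    exact hmf i hi
  · intro i hi
    rcases lt_or_ge i (n - (s + 1)) with h | h
    · rw [hst i h]
      exact hmt i h
    · rw [hm _ (by omega), coeff_vecPoly, dif_neg (by omega), ZMod.val_zero]
      exact hmz _ (by omega)

/-- Multiplies the polynomial in the first work area by `(X - y)^(s+1)`. -/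
def powerProg : RamProg :=
  block [.arith .add 13 3 7, .loop 13 (block [.arith .add 20 5 7, .arith .add 22 2 7, .const 24 0,
    mulLoop, .arith .sub 13 13 6])]

theorem halts_powerProg [Fact q.Prime] (hσ : Env s f y σ) (hs : s + 1 ≤ n) {p : (ZMod q)[X]}
    (hp : Stores σ (2 * n + 4) n p) (hB : 4 * n + 8 ≤ B) (hqB : q * q + q ≤ B) :
    Halts B powerProg σ ((s + 1) * (n * 10 + 7) + 3) fun τ =>
      Env s f y τ ∧ Stores τ (2 * n + 4) n ((X - C y) ^ (s + 1) * p) := by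
  have hy := ZMod.val_lt y
  refine Halts.mono (k := ((s + 1) * ((n * 10 + 1 + 2 + 3) + 1) + 1 + 1) + 1) ?_
    (le_of_eq (by ring)) fun _ h => h
  refine .arith (s + 1) (by simp [RamOp.eval, hσ.reg3, hσ.reg7]) (by omega) ?_
  refine Halts.seq (k := (s + 1) * ((n * 10 + 1 + 2 + 3) + 1) + 1) (l := 1) (Halts.loop
    (k := n * 10 + 1 + 2 + 3) (fun j τ => j ≤ s + 1 ∧ Env s f y τ ∧ τ.reg 13 = j ∧
      Stores τ (2 * n + 4) n ((X - C y) ^ (s + 1 - j) * p)) (s + 1) ?_ ?_ ?_) ?_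
  · exact ⟨le_rfl, hσ.setReg (by omega), by simp, by simpa [Stores] using hp⟩
  · rintro j hj τ ⟨-, hE, h13, hst⟩
    refine ⟨by omega, ?_⟩
    refine .arith (2 * n + 4) (by simp [RamOp.eval, hE.reg5, hE.reg7]) (by omega) ?_
    refine .arith n (by simp [RamOp.eval, hE.reg2, hE.reg7]) (by omega) ?_
    refine .const (by omega) ?_
    refine Halts.seq (k := n * 10 + 1) (l := 2) (halts_mulLoop (q := q) (y := y) (m := q - y.val)
      (W := 2 * n + 4) (n := n)
      (p := (X - C y) ^ (s + 1 - (j + 1)) * p) (by simp [hE.reg1]) (by simp [hE.reg6])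
      (by simp [hE.reg7]) (by simp [hE.reg14]) (by simp) (by simp) (by simp) hst
      (Nat.sub_le _ _) ?_ (by omega) hqB) ?_
    · rw [Nat.cast_sub hy.le, ZMod.natCast_self, ZMod.natCast_zmod_val, zero_sub]
    · rintro υ ⟨hF, hst'⟩
      have hE' : Env s f y υ :=
        (((hE.setReg (by omega)).setReg (by omega)).setReg (by omega)).frame hF (by omega)
      refine .arith j (by
        simp only [RamOp.eval]
        rw [hF.1 13 (by norm_num), hE'.reg6]
        simp [h13]) (by omega) ?_
      refine .skip ⟨hj.le, hE'.setReg (by omega), by simp, ?_⟩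
      rw [show s + 1 - j = s + 1 - (j + 1) + 1 by omega, pow_succ', mul_assoc]
      exact hst'
  · rintro τ ⟨-, -, h, -⟩
    exact h
  · rintro τ ⟨-, hE, -, hst⟩
    exact .skip ⟨hE, by simpa using hst⟩

theorem pow_succ_dvd_iff {F : Type*} [Field F] {p : F[X]} {x : F} {k : ℕ} :
    (X - C x) ^ (k + 1) ∣ p ↔ p.eval x = 0 ∧ (X - C x) ^ k ∣ p /ₘ (X - C x) := by
  constructor
  · intro h
    have h0 : X - C x ∣ p := (dvd_pow_self _ (Nat.succ_ne_zero k)).trans h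
    refine ⟨dvd_iff_isRoot.1 h0, ?_⟩
    obtain ⟨w, rfl⟩ := h
    rw [pow_succ', mul_assoc, mul_divByMonic_cancel_left _ (monic_X_sub_C x)]
    exact dvd_mul_right _ _
  · rintro ⟨h0, h⟩
    rw [← mul_divByMonic_eq_iff_isRoot.2 h0, pow_succ']
    exact mul_dvd_mul_left _ h

/-- Adds to register `9` the remainders of `s + 1` successive divisions by `X - x` of the polynomial
in the second work area, where register `11` holds `x`. They all vanish if and only if
`(X - x)^(s+1)` is a divisor. -/
def dvdProg : RamProg :=
  .loop 13 (block [.arith .add 20 8 2, .arith .add 22 2 7, .const 24 0, divLoop,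
    .arith .add 9 9 24, .arith .sub 13 13 6])

theorem halts_dvdProg [Fact q.Prime] (hσ : Env s f y σ) (hs : s + 1 ≤ n) {p : (ZMod q)[X]}
    (hpd : p.degree < n) (hp : Stores σ (3 * n + 4) n p) {x : ℕ} (hx : σ.reg 11 = x) (hxq : x ≤ q)
    (h9 : σ.reg 9 = 0) (h13 : σ.reg 13 = s + 1)
    (hB : 4 * n + 8 ≤ B) (hqB : q * q + q ≤ B) (hnB : (n + 1) * q ≤ B) :
    Halts B dvdProg σ ((s + 1) * (n * 9 + 8) + 1) fun τ => Env s f y τ ∧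
      (∀ r, r = 10 ∨ r = 11 ∨ r = 12 → τ.reg r = σ.reg r) ∧
      (∀ i < 3 * n + 4, τ.mem i = σ.mem i) ∧
      (τ.reg 9 = 0 ↔ (X - C (x : ZMod q)) ^ (s + 1) ∣ p) := by
  refine Halts.mono (Halts.loop (k := n * 9 + 1 + 3 + 3) (fun j τ => j ≤ s + 1 ∧ Env s f y τ ∧
      (∀ r, r = 10 ∨ r = 11 ∨ r = 12 → τ.reg r = σ.reg r) ∧
      (∀ i < 3 * n + 4, τ.mem i = σ.mem i) ∧ τ.reg 13 = j ∧ τ.reg 9 ≤ (s + 1 - j) * q ∧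
      ∃ e : (ZMod q)[X], e.degree < n ∧ Stores τ (3 * n + 4) n e ∧
        ((X - C (x : ZMod q)) ^ (s + 1) ∣ p ↔ τ.reg 9 = 0 ∧ (X - C (x : ZMod q)) ^ j ∣ e))
      (s + 1) ?_ ?_ ?_) le_rfl ?_
  · exact ⟨le_rfl, hσ, fun _ _ => rfl, fun _ _ => rfl, h13, by omega, p, hpd, hp, by simp [h9]⟩
  · rintro j hj τ ⟨-, hE, hr, hm, hr13, hle, e, hed, hst, hiff⟩
    refine ⟨by omega, ?_⟩
    have hr11 := (hr 11 (by omega)).trans hx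
    refine .arith (3 * n + 4 + n) (by simp [RamOp.eval, hE.reg8, hE.reg2]) (by omega) ?_
    refine .arith n (by simp [RamOp.eval, hE.reg2, hE.reg7]) (by omega) ?_
    refine .const (by omega) ?_
    refine Halts.seq (k := n * 9 + 1) (l := 3) (halts_divLoop (q := q) (x := (x : ZMod q)) (m := x)
      (W := 3 * n + 4) (n := n) (p := e) (by simp [hE.reg1]) (by simp [hE.reg6])
      (by simp [hr11]) (by simp) (by simp) (by simp) hst hed hxq rfl (by omega) hqB) ?_
    rintro υ ⟨hF, hst', h24⟩
    have hE' : Env s f y υ :=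
      (((hE.setReg (by omega)).setReg (by omega)).setReg (by omega)).frame hF (by omega)
    have hlt := ZMod.val_lt (e.eval (x : ZMod q))
    have h9' : υ.reg 9 = τ.reg 9 := by rw [hF.1 9 (by norm_num)]; simp
    have hstep : (s + 1 - j) * q = (s + 1 - (j + 1)) * q + q := by
      rw [show s + 1 - j = s + 1 - (j + 1) + 1 by omega, add_mul, one_mul]
    have hbig : (s + 1 - j) * q ≤ (n + 1) * q := Nat.mul_le_mul_right _ (by omega)
    refine .arith (τ.reg 9 + (e.eval (x : ZMod q)).val) (by simp [RamOp.eval, h9', h24])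
      (by omega) ?_
    refine .arith j (by
      simp only [RamOp.eval]
      rw [RamState.reg_setReg_of_ne _ (by norm_num), RamState.reg_setReg_of_ne _ (by norm_num),
        hF.1 13 (by norm_num), hE'.reg6]
      simp [hr13]) (by omega) ?_
    refine .skip ⟨hj.le, (hE'.setReg (by omega)).setReg (by omega), ?_, ?_, by simp, ?_,
      e /ₘ (X - C (x : ZMod q)), (degree_divByMonic_le _ _).trans_lt hed, hst', ?_⟩
    · intro r hr'
      rw [RamState.reg_setReg_of_ne _ (by omega), RamState.reg_setReg_of_ne _ (by omega),
        hF.1 r (by omega), RamState.reg_setReg_of_ne _ (by omega),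
        RamState.reg_setReg_of_ne _ (by omega), RamState.reg_setReg_of_ne _ (by omega), hr r hr']
    · intro i hi
      exact (hF.2 i (by omega)).trans (hm i hi)
    · simp
      omega
    · rw [hiff, pow_succ_dvd_iff]
      simp [ZMod.val_eq_zero, and_assoc]
  · rintro τ ⟨-, -, -, -, h, -⟩
    exact h
  · rintro τ ⟨-, hE, hr, hm, -, -, e, -, -, hiff⟩
    exact ⟨hE, hr, hm, by simpa using hiff.symm⟩

/-- Counts in register `10` the numbers `x` below `y` such that `(X - x)^(s+1)` divides the
polynomial in the first work area; the truncated difference `1 - r` is `1` exactly when `r = 0`. -/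
def repeatProg : RamProg :=
  block [.const 10 0, .const 11 0, .arith .add 12 4 7,
    .loop 12 (block [.arith .add 20 5 7, .arith .add 21 8 7, .arith .add 22 2 7, copyLoop,
      .const 9 0, .arith .add 13 3 7, dvdProg, .arith .sub 24 6 9, .arith .add 10 10 24,
      .arith .add 11 11 6, .arith .sub 12 12 6])]

theorem halts_repeatProg [Fact q.Prime] (hσ : Env s f y σ) (hs : s + 1 ≤ n) {p : (ZMod q)[X]}
    (hpd : p.degree < n) (hp : Stores σ (2 * n + 4) n p)
    (hB : 4 * n + 8 ≤ B) (hqB : q * q + q ≤ B) (hnB : (n + 1) * q ≤ B) :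
    Halts B repeatProg σ (y.val * ((s + 1) * (n * 9 + 8) + n * 7 + 13) + 5) fun τ =>
      Env s f y τ ∧ Stores τ (2 * n + 4) n p ∧
      (τ.reg 10 ≠ 0 ↔ HasPowerFactorBelow s y.val p) := by
  have hy := ZMod.val_lt y
  refine Halts.mono (k := (y.val * (((((s + 1) * (n * 9 + 8) + 1 + 5) + 2) + (n * 7 + 1) + 3) + 1)
    + 1 + 1) + 3) ?_ (le_of_eq (by ring)) fun _ h => h
  refine .const (by omega) ?_
  refine .const (by omega) ?_
  refine .arith y.val (by simp [RamOp.eval, hσ.reg4, hσ.reg7]) (by omega) ?_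
  refine Halts.seq
    (k := y.val * (((((s + 1) * (n * 9 + 8) + 1 + 5) + 2) + (n * 7 + 1) + 3) + 1) + 1) (l := 1)
    (Halts.loop (k := ((((s + 1) * (n * 9 + 8) + 1 + 5) + 2) + (n * 7 + 1) + 3))
    (fun j τ => j ≤ y.val ∧ Env s f y τ ∧ Stores τ (2 * n + 4) n p ∧ τ.reg 11 = y.val - j ∧
      τ.reg 12 = j ∧ τ.reg 10 ≤ y.val - j ∧
      (τ.reg 10 ≠ 0 ↔ HasPowerFactorBelow s (y.val - j) p)) y.val ?_ ?_ ?_) ?_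
  · refine ⟨le_rfl, ((hσ.setReg (by omega)).setReg (by omega)).setReg (by omega), hp, by simp,
      by simp, by simp, by simp [HasPowerFactorBelow]⟩
  · rintro j hj τ ⟨-, hE, hst, hr11, hr12, hle, hiff⟩
    refine ⟨by omega, ?_⟩
    refine .arith (2 * n + 4) (by simp [RamOp.eval, hE.reg5, hE.reg7]) (by omega) ?_
    refine .arith (3 * n + 4) (by simp [RamOp.eval, hE.reg8, hE.reg7]) (by omega) ?_
    refine .arith n (by simp [RamOp.eval, hE.reg2, hE.reg7]) (by omega) ?_
    rw [add_comm _ (n * 7 + 1)]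
    refine Halts.seq (k := n * 7 + 1) (halts_copyLoop (V := 2 * n + 4) (W := 3 * n + 4) (n := n)
      (by simp [hE.reg6]) (by simp) (by simp) (by simp) (by omega) (by omega)) ?_
    rintro υ ⟨hF, hcopy⟩
    have hE' : Env s f y υ :=
      (((hE.setReg (by omega)).setReg (by omega)).setReg (by omega)).frame hF (by omega)
    have hreg : ∀ r < 20, υ.reg r = τ.reg r := fun r hr => by
      rw [hF.1 r hr, RamState.reg_setReg_of_ne _ (by omega),
        RamState.reg_setReg_of_ne _ (by omega), RamState.reg_setReg_of_ne _ (by omega)]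
    have hst1 : Stores υ (2 * n + 4) n p := fun i hi =>
      (hF.2 _ (by omega)).trans (hst i hi)
    have hst2 : Stores υ (3 * n + 4) n p := fun i hi => (hcopy i hi).trans (hst i hi)
    refine .const (by omega) ?_
    refine .arith (s + 1) (by simp [RamOp.eval, hE'.reg3, hE'.reg7]) (by omega) ?_
    refine Halts.seq (k := (s + 1) * (n * 9 + 8) + 1) (l := 5) (halts_dvdProg (p := p)
      (x := y.val - (j + 1)) ((hE'.setReg (by omega)).setReg (by omega)) hs hpd hst2
      (by simp [hreg, hr11]) (by omega) (by simp) (by simp) hB hqB hnB) ?_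
    rintro ρ ⟨hE'', hr, hm, h9⟩
    have h10 : ρ.reg 10 = τ.reg 10 := by
      rw [hr 10 (by omega)]
      simp [hreg]
    have h11 : ρ.reg 11 = y.val - (j + 1) := by
      rw [hr 11 (by omega)]
      simp [hreg, hr11]
    have h12 : ρ.reg 12 = j + 1 := by
      rw [hr 12 (by omega)]
      simp [hreg, hr12]
    refine .arith (1 - ρ.reg 9) (by simp [RamOp.eval, hE''.reg6]) (by omega) ?_
    refine .arith (τ.reg 10 + (1 - ρ.reg 9)) (by simp [RamOp.eval, h10]) (by omega) ?_
    refine .arith (y.val - j) (by simp [RamOp.eval, h11, hE''.reg6]; omega) (by omega) ?_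
    refine .arith j (by simp [RamOp.eval, h12, hE''.reg6]) (by omega) ?_
    refine .skip ⟨hj.le, (((hE''.setReg (by omega)).setReg (by omega)).setReg (by omega)).setReg
      (by omega), fun i hi => (hm _ (by omega)).trans (hst1 i hi), by simp, by simp, ?_, ?_⟩
    · simp
      omega
    · have hsum : (τ.reg 10 + (1 - ρ.reg 9) ≠ 0) ↔ (τ.reg 10 ≠ 0 ∨ ρ.reg 9 = 0) := by omega
      rw [RamState.reg_setReg_of_ne _ (by norm_num), RamState.reg_setReg_of_ne _ (by norm_num),
        RamState.reg_setReg_self, hsum, hiff, h9]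
      constructor
      · rintro (⟨x, hx, hd⟩ | hd)
        · exact ⟨x, by omega, hd⟩
        · exact ⟨_, by omega, hd⟩
      · rintro ⟨x, hx, hd⟩
        rcases Nat.lt_or_ge x (y.val - (j + 1)) with h | h
        · exact Or.inl ⟨x, h, hd⟩
        · exact Or.inr ((show x = y.val - (j + 1) by omega) ▸ hd)
  · rintro τ ⟨-, -, -, -, h, -⟩
    exact h
  · rintro τ ⟨-, hE, hst, -, -, -, hiff⟩
    exact .skip ⟨hE, hst, by simpa using hiff⟩

/-- Writes `⊥` if register `10` is not zero, and otherwise the sum of `f` and the first work area. The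
sum is written two cells below `f`, so that no entry of `f` is overwritten before it is read. -/
def outputProg : RamProg :=
  .branch 10 (block [.store 7 7, .arith .add 0 6 7])
    (block [.const 20 3, .arith .add 21 5 7, .arith .add 22 2 7, .const 23 1, addLoop, .store 7 6,
      .arith .add 0 2 6])

theorem halts_outputProg [Fact q.Prime] (hσ : Env s f y σ) {g : Fin n → ZMod q}
    (hp : Stores σ (2 * n + 4) n (vecPoly g)) {o : Option (Fin n → ZMod q)}
    (hnone : σ.reg 10 ≠ 0 → o = none) (hsome : σ.reg 10 = 0 → o = some (f + g))
    (hB : 4 * n + 8 ≤ B) (hqB : q * q + q ≤ B) :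
    Halts B outputProg σ (n * 11 + 9) fun τ => τ.HasOutput (encodeOptVec o) := by
  refine Halts.mono (k := ((n * 11 + 1) + 3 + 4) + 1) ?_ (by omega) fun _ h => h
  refine Halts.branch (fun h => ?_) (fun h => ?_)
  · rw [hnone h]
    refine Halts.mono (k := 3) ?_ (by omega) fun _ h => h
    refine .store 0 0 hσ.reg7 hσ.reg7 ?_
    refine .arith 1 (by simp [RamOp.eval, hσ.reg6, hσ.reg7]) (by omega) ?_
    refine .skip ?_
    simp [RamState.HasOutput, encodeOptVec, RamState.mem_setMem]
  · rw [hsome h]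
    have hq1 : q ≤ q * q := Nat.le_mul_self q
    refine .const (by omega) ?_
    refine .arith (2 * n + 4) (by simp [RamOp.eval, hσ.reg5, hσ.reg7]) (by omega) ?_
    refine .arith n (by simp [RamOp.eval, hσ.reg2, hσ.reg7]) (by omega) ?_
    refine .const (by omega) ?_
    refine Halts.seq (k := n * 11 + 1) (l := 3) (halts_addLoop (q := q) (U := 3) (V := 2 * n + 4)
      (W := 1) (n := n) (f := vecPoly f) (g := vecPoly g) (by simp [hσ.reg1])
      (by simp [hσ.reg6]) (by simp) (by simp) (by simp) (by simp) hσ.stores hp (by omega)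
      (by omega) (by omega) (by omega)) ?_
    rintro τ ⟨hF, hst⟩
    have h7 : τ.reg 7 = 0 := by rw [hF.1 7 (by norm_num)]; simp [hσ.reg7]
    have h6 : τ.reg 6 = 1 := by rw [hF.1 6 (by norm_num)]; simp [hσ.reg6]
    have h2 : τ.reg 2 = n := by rw [hF.1 2 (by norm_num)]; simp [hσ.reg2]
    refine .store 0 1 h7 h6 ?_
    refine .arith (n + 1) (by simp [RamOp.eval, h2, h6]) (by omega) ?_
    refine .skip ⟨by simp [encodeOptVec, encodeVec], fun i hi => ?_⟩
    simp only [encodeOptVec, encodeVec, List.length_cons, List.length_ofFn] at hi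
    rw [RamState.mem_setReg, RamState.mem_setMem]
    rcases i with _ | i
    · simp [encodeOptVec]
    · have hi' : i < n := by omega
      rw [if_neg (Nat.succ_ne_zero i), add_comm i 1, hst i hi', ← vecPoly_add, coeff_vecPoly,
        dif_pos hi']
      simp [encodeOptVec, encodeVec, add_comm 1 i, hi']

/-- The program for `ktNeighbor`. -/
def neighborProg : RamProg :=
  .seq setupProg (.seq powerProg (.seq repeatProg outputProg))

theorem neighborProg_computesWithin [Fact q.Prime] (hs : s + 1 < n) (f : Fin n → ZMod q)
    (y : ZMod q) (t : Fin (n - (s + 1)) → ZMod q) :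
    neighborProg.ComputesWithin ([q, n, s] ++ encodeVec f ++ [y.val] ++ encodeVec t)
      (encodeOptVec (ktNeighbor s f (y, t))) (10 ^ 6 * (n + q) ^ 6) := by
  classical
  have hq2 : 2 ≤ q := (Fact.out : q.Prime).two_le
  have hn2 : 2 ≤ n := by omega
  set B := 4 * (n + q) ^ 2 with hBdef
  have hB : 4 * n + 8 ≤ B := by nlinarith
  have hqB : q * q + q ≤ B := by nlinarith
  have hnB : (n + 1) * q ≤ B := by nlinarith
  have hqB' : q ≤ B := by nlinarith
  have hvec : vecPoly (mulVec n ((X - C y) ^ (s + 1)) t) = (X - C y) ^ (s + 1) * vecPoly t :=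
    vecPoly_mulVec (by rw [natDegree_X_sub_C_pow]) t
  have hmain := (halts_setupProg (B := B) (f := f) (y := y) hs.le t hB hqB').seq fun τ hτ =>
    (halts_powerProg hτ.1 hs.le hτ.2 hB hqB).seq fun τ hτ =>
      (halts_repeatProg (p := (X - C y) ^ (s + 1) * vecPoly t) hτ.1 hs.le
        (hvec ▸ degree_vecPoly_lt _) hτ.2 hB hqB hnB).seq fun τ hτ =>
        halts_outputProg (g := mulVec n ((X - C y) ^ (s + 1)) t) (o := ktNeighbor s f (y, t)) hτ.1
          (by rw [hvec]; exact hτ.2.1)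
          (fun h => by simp only [ktNeighbor]; rw [if_pos (hτ.2.2.1 h)])
          (fun h => by
            simp only [ktNeighbor]
            rw [if_neg (fun h' => (hτ.2.2.2 h') h)]) hB hqB
  refine hmain.computesWithin ?_ ?_ ?_
  · simp [encodeVec]
    omega
  · intro x hx
    simp only [encodeVec, List.mem_append, List.mem_cons, List.not_mem_nil, or_false,
      List.mem_ofFn] at hx
    rcases hx with ((hx | ⟨i, rfl⟩) | hx) | ⟨i, rfl⟩
    · omega
    · exact (ZMod.val_lt _).le.trans hqB'
    · exact hx ▸ (ZMod.val_lt _).le.trans hqB'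
    · exact (ZMod.val_lt _).le.trans hqB'
  · have hy := (ZMod.val_lt y).le
    set M := n + q with hM
    have hsize : 1 + 3 * B.size ≤ 16 * M ^ 2 := by
      have h1 : B.size ≤ B := Nat.size_le.2 Nat.lt_two_pow_self
      have h2 : 4 ≤ M ^ 2 := by nlinarith
      omega
    have hsM : s + 1 ≤ M := by omega
    have hnM : n ≤ M := by omega
    have hyM : y.val ≤ M := by omega
    have hM1 : 1 ≤ M := by omega
    have hb : ∀ i j : ℕ, i ≤ j → M ^ i ≤ M ^ j := fun i j h => Nat.pow_le_pow_right hM1 h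
    have h1 : (s + 1) * (n * 10 + 7) ≤ 17 * M ^ 2 := by
      calc (s + 1) * (n * 10 + 7) ≤ M * (M * 10 + 7 * M) := by gcongr; omega
        _ = 17 * M ^ 2 := by ring
    have h2 : (s + 1) * (n * 9 + 8) + n * 7 + 13 ≤ 37 * M ^ 2 := by
      calc (s + 1) * (n * 9 + 8) + n * 7 + 13 ≤ M * (M * 9 + 8 * M) + M * M * 7 + 13 * (M * M) := by
            gcongr
            · omega
            · nlinarith
            · nlinarith
        _ = 37 * M ^ 2 := by ring
    have h3 : y.val * ((s + 1) * (n * 9 + 8) + n * 7 + 13) ≤ 37 * M ^ 3 := by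
      calc y.val * ((s + 1) * (n * 9 + 8) + n * 7 + 13) ≤ M * (37 * M ^ 2) := Nat.mul_le_mul hyM h2
        _ = 37 * M ^ 3 := by ring
    have h23 := hb 2 4 (by norm_num)
    have h34 := hb 3 4 (by norm_num)
    have h14 := hb 1 4 (by norm_num)
    have h04 := hb 0 4 (by norm_num)
    rw [pow_one] at h14
    rw [pow_zero] at h04
    calc _ ≤ (1000 * M ^ 4) * (16 * M ^ 2) := Nat.mul_le_mul (by omega) hsize
      _ = 16000 * M ^ 6 := by ring
      _ ≤ 10 ^ 6 * M ^ 6 := Nat.mul_le_mul_right _ (by norm_num)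

end RamProg

/-! ### Parameters -/

/-- Expansion of the bipartite half, in integers: the loss of a factor `999/1000` on the way from
left to right and of a factor `199/200` on the way back amount to at most `1/100`. -/
theorem ktHalf_expansion {F : Type*} [Field F] [Fintype F] {n s h : ℕ}
    (hF : ∀ k < Fintype.card F, k ≠ 0 → (k : F) ≠ 0) (hn : n ≤ Fintype.card F) (hsn : s + 1 < n)
    (hcard : 1000 * ((s + 2) * (h * n)) ≤ Fintype.card F) (S : Finset (Fin n → F))
    (hh : S.card * Fintype.card F < h ^ (s + 2))
    (hov : 200 * (S.card * Fintype.card F * Fintype.card F ^ (n - 2 * (s + 1))) ≤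
      Fintype.card F ^ (n - (s + 1))) :
    99 * (Fintype.card F * Fintype.card F ^ (n - (s + 1)) * S.card) ≤
      100 * ((ktHalf F n s).nbrsOf S).ncard := by
  have h1 := mul_card_le_card_ktNbrs (by omega) hF hn (by omega) (h := h) (by omega) S hh
  have h2 := card_ktNbrs_le (s := s) S
  have h3 := card_ktNbrs_mul_le_ncard_nbrsOf (s := s) (fun k hk => hF k (by omega)) S
  set x := (ktNbrs s S).card
  set a := Fintype.card F ^ (n - (s + 1))
  set b := Fintype.card F ^ (n - 2 * (s + 1))
  set q := Fintype.card F
  set w := (s + 2) * (h * n)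
  have h4 : 999 * (q * S.card) ≤ 1000 * x := by
    calc 999 * (q * S.card) = 999 * q * S.card := by ring
      _ ≤ 1000 * (q - w) * S.card := Nat.mul_le_mul_right _ (by omega)
      _ = 1000 * ((q - w) * S.card) := by ring
      _ ≤ 1000 * x := Nat.mul_le_mul_left _ h1
  have h5 : 200 * (x * (x * b)) ≤ x * a := by
    calc 200 * (x * (x * b)) = x * (200 * (x * b)) := by ring
      _ ≤ x * (200 * (S.card * q * b)) := by gcongr
      _ ≤ x * a := Nat.mul_le_mul_left _ hov
  have h6 : 999 * (q * a * S.card) ≤ 1000 * (x * a) := by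
    calc 999 * (q * a * S.card) = 999 * (q * S.card) * a := by ring
      _ ≤ 1000 * x * a := Nat.mul_le_mul_right _ h4
      _ = 1000 * (x * a) := by ring
  omega

theorem mul_pow_self_mono {c c' x : ℕ} (hx : 1 ≤ x) (h : c ≤ c') : c * x ^ c ≤ c' * x ^ c' :=
  Nat.mul_le_mul h (Nat.pow_le_pow_right hx h)

theorem RamProg.primeProg_computesWithin {C : ℕ} (hC : C ≠ 0) : ∃ c : ℕ, ∀ n : ℕ, 1 ≤ n →
    (primeProg C).ComputesWithin [n] [primeAbovePow C n] (c * n ^ c) := by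
  refine ⟨(18 * C + 108) * (3 * C + 19) + 3 * C, fun n hn => ?_⟩
  have hq := primeAbovePow_le (C := C) hn
  have hqn := lt_primeAbovePow C n
  set q := primeAbovePow C n
  obtain ⟨M, hM⟩ : ∃ M, M = n ^ C := ⟨_, rfl⟩
  rw [← hM] at hq hqn
  have hM1 : 1 ≤ M := hM ▸ Nat.one_le_pow _ _ hn
  set B := 2 * q + C + n + 1 with hB
  refine (halts_primeProg (B := B) hn le_rfl).computesWithin (by simp; omega) (by simp; omega) ?_
  have hnM : n ≤ M := hM ▸ Nat.le_self_pow hC n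
  have hCM : C ≤ C * M := Nat.le_mul_of_pos_right C hM1
  have hBM : B ≤ (C + 6) * M := by
    rw [add_mul]
    omega
  have hsize : 1 + 3 * B.size ≤ (3 * C + 19) * M := by
    have h1 : B.size ≤ B := Nat.size_le.2 Nat.lt_two_pow_self
    calc 1 + 3 * B.size ≤ M + 3 * ((C + 6) * M) := by omega
      _ = (3 * C + 19) * M := by ring
  have hsteps : C * 4 + q * (7 * B + 7) + 10 ≤ (18 * C + 108) * M ^ 2 := by
    have h2 : q * (7 * B + 7) ≤ 2 * M * (7 * ((C + 6) * M) + 7 * M) :=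
      Nat.mul_le_mul hq (by omega)
    have h3 : 2 * M * (7 * ((C + 6) * M) + 7 * M) = (14 * C + 98) * M ^ 2 := by ring
    have h4 : C * 4 + 10 ≤ (4 * C + 10) * M ^ 2 :=
      (by omega : C * 4 + 10 ≤ (4 * C + 10) * 1).trans
        (Nat.mul_le_mul_left _ (Nat.one_le_pow _ _ hM1))
    calc _ ≤ (14 * C + 98) * M ^ 2 + (4 * C + 10) * M ^ 2 := by omega
      _ = (18 * C + 108) * M ^ 2 := by ring
  calc _ ≤ (18 * C + 108) * M ^ 2 * ((3 * C + 19) * M) := Nat.mul_le_mul hsteps hsize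
    _ = (18 * C + 108) * (3 * C + 19) * n ^ (3 * C) := by
      rw [mul_comm 3 C, pow_mul, ← hM]
      ring
    _ ≤ _ := by
      refine Nat.mul_le_mul (Nat.le_add_right _ _) (Nat.pow_le_pow_right hn (Nat.le_add_left _ _))

theorem primeAbovePow_le_logb_pow (C : ℕ) : ∃ c : ℕ, ∀ n : ℕ, 1 ≤ n →
    (RamProg.primeAbovePow C n : ℝ) ≤
      c * Real.logb 2 ((RamProg.primeAbovePow C n : ℝ) ^ n) ^ c := by
  refine ⟨C + 2, fun n hn => ?_⟩
  have hq := RamProg.primeAbovePow_le (C := C) hn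
  have hq2 := (RamProg.primeAbovePow_prime C n).two_le
  set q := RamProg.primeAbovePow C n
  have hlog : (n : ℝ) ≤ Real.logb 2 ((q : ℝ) ^ n) := by
    rw [Real.logb_pow]
    have : (1 : ℝ) ≤ Real.logb 2 q := by
      rw [Real.le_logb_iff_rpow_le (by norm_num) (by positivity), Real.rpow_one]
      exact_mod_cast hq2
    nlinarith [(Nat.cast_nonneg n : (0 : ℝ) ≤ n)]
  have hn1 : (1 : ℝ) ≤ n := by exact_mod_cast hn
  calc (q : ℝ) ≤ 2 * (n : ℝ) ^ C := by exact_mod_cast hq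
    _ ≤ ((C + 2 : ℕ) : ℝ) * (n : ℝ) ^ (C + 2) := by
      have h2 : (2 : ℝ) ≤ ((C + 2 : ℕ) : ℝ) := by exact_mod_cast Nat.le_add_left 2 C
      have h3 : (n : ℝ) ^ C ≤ (n : ℝ) ^ (C + 2) := pow_le_pow_right₀ hn1 (Nat.le_add_right _ _)
      gcongr
    _ ≤ _ := by gcongr

/-- The order of vanishing: `s + 1 = ⌊1.01 δ n⌋`. -/
noncomputable def jetOrder (δ : ℝ) (n : ℕ) : ℕ := ⌊1.01 * δ * n⌋₊ - 1

theorem jetOrder_div (a b n : ℕ) :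
    jetOrder ((a : ℝ) / b) n = 101 * a * n / (100 * b) - 1 := by
  rw [jetOrder, ← Nat.floor_div_eq_div (K := ℝ)]
  congr 2
  push_cast
  ring

section Numerics

variable {n q s : ℕ} {δ : ℝ}

/-- If `q > n ^ 606`, then `h = q / (1000 n²)` is at least `q ^ (201 / 202)`. -/
theorem rpow_le_div_natCast (hn : 20000 ≤ n) (hq : n ^ 606 < q) :
    (q : ℝ) ^ (201 / 202 : ℝ) ≤ ((q / (1000 * n ^ 2) : ℕ) : ℝ) := by
  have hq1 : 1 ≤ q := (Nat.zero_le _).trans_lt hq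
  have hqr : (1 : ℝ) ≤ q := by exact_mod_cast hq1
  have hq0 : (0 : ℝ) < q := by linarith
  have hnr : (20000 : ℝ) ≤ n := by exact_mod_cast hn
  have h1 : (n : ℝ) ^ 3 ≤ (q : ℝ) ^ (1 / 202 : ℝ) := by
    have h : (((n : ℝ) ^ 3) ^ 202) ≤ q := by
      have h := (Nat.cast_le (α := ℝ)).2 hq.le
      rwa [Nat.cast_pow, show 606 = 3 * 202 by norm_num, pow_mul] at h
    calc (n : ℝ) ^ 3 = (((n : ℝ) ^ 3) ^ 202) ^ (1 / 202 : ℝ) := by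
          rw [one_div]
          exact_mod_cast (Real.pow_rpow_inv_natCast (n := 202) (by positivity : (0 : ℝ) ≤ n ^ 3)
            (by norm_num)).symm
      _ ≤ _ := Real.rpow_le_rpow (by positivity) h (by norm_num)
  have h2 : (1 : ℝ) ≤ (q : ℝ) ^ (201 / 202 : ℝ) := Real.one_le_rpow hqr (by norm_num)
  have h3 : (q : ℝ) ^ (201 / 202 : ℝ) * (q : ℝ) ^ (1 / 202 : ℝ) = q := by
    rw [← Real.rpow_add hq0]
    norm_num
  have h4 : 2 * (q : ℝ) ^ (201 / 202 : ℝ) ≤ q / (1000 * n ^ 2 : ℕ) := by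
    have hn0 : (0 : ℝ) < (n : ℝ) ^ 2 := by positivity
    rw [le_div_iff₀ (by positivity)]
    push_cast
    calc 2 * (q : ℝ) ^ (201 / 202 : ℝ) * (1000 * (n : ℝ) ^ 2)
        = (q : ℝ) ^ (201 / 202 : ℝ) * (2000 * (n : ℝ) ^ 2) := by ring
      _ ≤ (q : ℝ) ^ (201 / 202 : ℝ) * (n : ℝ) ^ 3 := by
        gcongr
        rw [pow_succ (n : ℝ) 2, mul_comm]
        gcongr
        linarith
      _ ≤ (q : ℝ) ^ (201 / 202 : ℝ) * (q : ℝ) ^ (1 / 202 : ℝ) := by gcongr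
      _ = q := h3
  have h5 := Nat.lt_floor_add_one ((q : ℝ) / (1000 * n ^ 2 : ℕ))
  rw [Nat.floor_div_eq_div] at h5
  linarith

/-- The vertex bound `K ≤ N ^ δ` makes the interpolation possible. -/
theorem card_mul_lt_pow (hn : 20000 ≤ n) (hq : n ^ 606 < q) (hδn : 400 ≤ δ * n)
    (hs : 1.01 * δ * n < s + 2) {k : ℕ} (hk : (k : ℝ) ≤ (q : ℝ) ^ (δ * n)) :
    k * q < (q / (1000 * n ^ 2)) ^ (s + 2) := by
  have hq2 : 2 ≤ q :=
    ((by omega : 2 ≤ n).trans (Nat.le_self_pow (by norm_num) n)).trans hq.le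
  have hqr : (1 : ℝ) < q := by exact_mod_cast hq2
  have hq0 : (0 : ℝ) < q := by linarith
  have h1 : (k : ℝ) * q ≤ (q : ℝ) ^ (δ * n + 1) := by
    rw [Real.rpow_add hq0, Real.rpow_one]
    gcongr
  have h2 : (q : ℝ) ^ (δ * n + 1) < (q : ℝ) ^ ((201 / 202 : ℝ) * ((s + 2 : ℕ) : ℝ)) := by
    refine Real.rpow_lt_rpow_of_exponent_lt hqr ?_
    push_cast
    linarith
  have h3 : (q : ℝ) ^ ((201 / 202 : ℝ) * ((s + 2 : ℕ) : ℝ)) ≤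
      ((q / (1000 * n ^ 2) : ℕ) : ℝ) ^ (s + 2) := by
    rw [Real.rpow_mul hq0.le, Real.rpow_natCast]
    exact pow_le_pow_left₀ (by positivity) (rpow_le_div_natCast hn hq) _
  exact_mod_cast h1.trans_lt (h2.trans_le h3)

/-- Both vertex bounds together make the overlaps of the fibres negligible. -/
theorem overlap_le (hq : 200 ≤ q) (hδn : 400 ≤ δ * n)
    (hs : 1.01 * δ * n < s + 2) (hs' : (s : ℝ) + 1 ≤ 1.01 * δ * n) (hsn : s + 1 < n) {k : ℕ}
    (hk : (k : ℝ) ≤ (q : ℝ) ^ (δ * n)) (hk' : (k : ℝ) ≤ (q : ℝ) ^ (n - 1.01 * δ * n - 2)) :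
    200 * (k * q * q ^ (n - 2 * (s + 1))) ≤ q ^ (n - (s + 1)) := by
  have hqr : (200 : ℝ) ≤ q := by exact_mod_cast hq
  have hq0 : (0 : ℝ) < q := by linarith
  rcases Nat.le_total (2 * (s + 1)) n with h | h
  · have h1 : q ^ (n - (s + 1)) = q ^ (s + 1) * q ^ (n - 2 * (s + 1)) := by
      rw [← pow_add]
      congr 1
      omega
    rw [h1, ← mul_assoc]
    refine Nat.mul_le_mul_right _ ?_
    have h2 : (200 : ℝ) * (k * q) ≤ (q : ℝ) ^ (s + 1) := by
      calc (200 : ℝ) * (k * q) ≤ q * ((q : ℝ) ^ (δ * n) * q) := by gcongr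
        _ = (q : ℝ) ^ (δ * n + 1 + 1) := by
          rw [Real.rpow_add hq0, Real.rpow_add hq0, Real.rpow_one]
          ring
        _ ≤ (q : ℝ) ^ ((s + 1 : ℕ) : ℝ) := by
          refine Real.rpow_le_rpow_of_exponent_le (by linarith) ?_
          push_cast
          linarith
        _ = (q : ℝ) ^ (s + 1) := Real.rpow_natCast _ _
    exact_mod_cast h2
  · rw [Nat.sub_eq_zero_of_le h, pow_zero, mul_one]
    have h2 : (200 : ℝ) * (k * q) ≤ (q : ℝ) ^ (n - (s + 1)) := by
      calc (200 : ℝ) * (k * q) ≤ q * ((q : ℝ) ^ (n - 1.01 * δ * n - 2) * q) := by gcongr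
        _ = (q : ℝ) ^ (n - 1.01 * δ * n - 2 + 1 + 1) := by
          rw [Real.rpow_add hq0, Real.rpow_add hq0, Real.rpow_one]
          ring
        _ ≤ (q : ℝ) ^ ((n - (s + 1) : ℕ) : ℝ) := by
          refine Real.rpow_le_rpow_of_exponent_le (by linarith) ?_
          rw [Nat.cast_sub hsn.le]
          push_cast
          linarith
        _ = (q : ℝ) ^ (n - (s + 1)) := Real.rpow_natCast _ _
    exact_mod_cast h2

end Numerics

/-- The quantitative part of the theorem, for a single prime `q > n ^ 606` and large `n`. -/
theorem ktHalf_isLosslessExpander {n q s : ℕ} [Fact q.Prime] {δ : ℝ} (hn : 20000 ≤ n)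
    (hq : n ^ 606 < q) (hδn : 400 ≤ δ * n) (hs : 1.01 * δ * n < s + 2)
    (hs' : (s : ℝ) + 1 ≤ 1.01 * δ * n) (hsn : s + 1 < n) :
    ∃ D : ℕ, (ktHalf (ZMod q) n s).IsLosslessExpander D
        (min (((q ^ n : ℕ) : ℝ) ^ δ) (((q ^ n : ℕ) : ℝ) ^ (1 - 1.01 * δ - 2 / n))) 0.01 ∧
      ((q ^ n : ℕ) : ℝ) ^ (1 - 1.01 * δ) ≤ D ∧
      (D : ℝ) ≤ ((q ^ n : ℕ) : ℝ) ^ (1 - 1.01 * δ + 2 / n) := by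
  have hnq : n < q := lt_of_le_of_lt (Nat.le_self_pow (by norm_num) n) hq
  have hqr : (200 : ℝ) ≤ q := by exact_mod_cast (by omega : 200 ≤ q)
  have hq0 : (0 : ℝ) < q := by linarith
  have hn0 : (n : ℝ) ≠ 0 := by
    have : n ≠ 0 := by omega
    exact_mod_cast this
  have hNpow : ∀ x : ℝ, ((q ^ n : ℕ) : ℝ) ^ x = (q : ℝ) ^ (n * x) := fun x => by
    rw [Nat.cast_pow, ← Real.rpow_natCast, ← Real.rpow_mul hq0.le]
  have hF : ∀ k < Fintype.card (ZMod q), k ≠ 0 → (k : ZMod q) ≠ 0 := by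
    intro k hk hk0 h
    rw [ZMod.card] at hk
    rw [ZMod.natCast_eq_zero_iff] at h
    exact absurd (Nat.le_of_dvd (Nat.pos_of_ne_zero hk0) h) (by omega)
  have hFs : ∀ k ≤ s, k ≠ 0 → (k : ZMod q) ≠ 0 := fun k hk =>
    hF k (by rw [ZMod.card]; omega)
  have hDlow := pow_le_ncard_nbrs_ktHalf (n := n) hFs
  have hDup := ncard_nbrs_ktHalf_le (n := n) hFs
  rw [ZMod.card] at hDlow hDup
  refine ⟨((ktHalf (ZMod q) n s).nbrs 0).ncard, ⟨ktHalf_isRegular hFs, fun S hS => ?_⟩, ?_, ?_⟩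
  · have hS1 : (S.card : ℝ) ≤ (q : ℝ) ^ (δ * n) := by
      refine (hS.trans (min_le_left _ _)).trans_eq ?_
      rw [hNpow, mul_comm]
    have hS2 : (S.card : ℝ) ≤ (q : ℝ) ^ (n - 1.01 * δ * n - 2) := by
      refine (hS.trans (min_le_right _ _)).trans_eq ?_
      rw [hNpow]
      congr 1
      field_simp
    have key := ktHalf_expansion (s := s) (h := q / (1000 * n ^ 2)) hF
      (by rw [ZMod.card]; exact hnq.le) hsn ?_ S
      (by rw [ZMod.card]; exact card_mul_lt_pow hn hq hδn hs hS1)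
      (by rw [ZMod.card]; exact overlap_le (by omega) hδn hs hs' hsn hS1 hS2)
    · rw [ZMod.card] at key
      have key' : (99 : ℝ) * (q * q ^ (n - (s + 1)) * S.card) ≤
          100 * (((ktHalf (ZMod q) n s).nbrsOf S).ncard : ℝ) := by exact_mod_cast key
      have hD : (((ktHalf (ZMod q) n s).nbrs 0).ncard : ℝ) ≤ q * q ^ (n - (s + 1)) := by
        exact_mod_cast hDup
      have := mul_le_mul_of_nonneg_right hD (Nat.cast_nonneg S.card : (0 : ℝ) ≤ S.card)
      norm_num
      linarith
    · rw [ZMod.card]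
      calc 1000 * ((s + 2) * (q / (1000 * n ^ 2) * n)) ≤ 1000 * (n * (q / (1000 * n ^ 2) * n)) := by
            gcongr
            omega
        _ = q / (1000 * n ^ 2) * (1000 * n ^ 2) := by ring
        _ ≤ q := Nat.div_mul_le_self _ _
  · calc ((q ^ n : ℕ) : ℝ) ^ (1 - 1.01 * δ) = (q : ℝ) ^ (n * (1 - 1.01 * δ)) := hNpow _
      _ ≤ (q : ℝ) ^ ((n - (s + 1) : ℕ) : ℝ) := by
        refine Real.rpow_le_rpow_of_exponent_le (by linarith) ?_
        rw [Nat.cast_sub hsn.le]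
        push_cast
        linarith
      _ = ((q ^ (n - (s + 1)) : ℕ) : ℝ) := by rw [Real.rpow_natCast, Nat.cast_pow]
      _ ≤ _ := by exact_mod_cast hDlow
  · calc (((ktHalf (ZMod q) n s).nbrs 0).ncard : ℝ) ≤ ((q * q ^ (n - (s + 1)) : ℕ) : ℝ) := by
          exact_mod_cast hDup
      _ = (q : ℝ) ^ (((n - (s + 1) : ℕ) : ℝ) + 1) := by
        rw [Real.rpow_add hq0, Real.rpow_natCast, Real.rpow_one]
        push_cast
        ring
      _ ≤ (q : ℝ) ^ (n * (1 - 1.01 * δ + 2 / n)) := by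
        refine Real.rpow_le_rpow_of_exponent_le (by linarith) ?_
        rw [Nat.cast_sub hsn.le, mul_add, mul_div_cancel₀ _ hn0]
        push_cast
        linarith
      _ = _ := (hNpow _).symm


/-! ### The family of expanders -/

/-- The family is indexed by `n`, with `N = q(n)^n` vertices; one sequence of values of `N`, one
bound on `q` and the same programs serve all `δ`. -/
theorem mainTheorem5 :
    ∃ (Pq Ps PΓ : RamProg) (c : ℕ) (q : ℕ → ℕ),
      -- `q(n)` is a prime above `n`, polynomial in `log N`, found in time polynomial in `n`
      (∀ n : ℕ, 1 ≤ n →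
        (q n).Prime ∧ n < q n ∧
        (q n : ℝ) ≤ c * (Real.logb 2 ((q n : ℝ) ^ n)) ^ c ∧
        Pq.ComputesWithin [n] [q n] (c * n ^ c)) ∧
      ∀ δ : ℝ, 0 < δ → δ < 0.99 →
        ∃ (s : ℕ → ℕ) (o : ℕ → ℝ),
          Tendsto o atTop (𝓝 0) ∧
          ∀ᶠ n : ℕ in atTop, ∃ N D : ℕ,
            N = q n ^ n ∧
            Nat.card (Fin n → ZMod (q n)) = N ∧
            s n + 1 < n ∧
            (ktHalf (ZMod (q n)) n (s n)).IsLosslessExpander D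
              (min ((N : ℝ) ^ δ) ((N : ℝ) ^ (1 - 1.01 * δ - o n))) 0.01 ∧
            (N : ℝ) ^ (1 - 1.01 * δ) ≤ D ∧
            (D : ℝ) ≤ (N : ℝ) ^ (1 - 1.01 * δ + o n) ∧
            ¬ (ktHalf (ZMod (q n)) n (s n)).IsBipartite ∧
            -- explicitness: neighbours in time `poly(n, q)`; for rational `δ` also the parameter `s`
            ListsNeighbors PΓ (s n) (ktHalf (ZMod (q n)) n (s n)) (c * (n + q n) ^ c) ∧
            (∀ a b : ℕ, 0 < b → δ = (a : ℝ) / b →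
              Ps.ComputesWithin [n, a, b] [s n] (c * (n + a.size + b.size) ^ c)) ∧
            -- scaling by the multiplicative group on the graph without the zero vertex
            ∃ _ : MulAction (ZMod (q n))ˣ {f : Fin n → ZMod (q n) // f ≠ 0},
              (∀ (a : (ZMod (q n))ˣ) (f : {f : Fin n → ZMod (q n) // f ≠ 0}),
                (a • f).1 = (a : ZMod (q n)) • f.1) ∧
              IsFreeAction (ZMod (q n))ˣ {f : Fin n → ZMod (q n) // f ≠ 0} ∧
              ((ktHalf (ZMod (q n)) n (s n)).deleteVertex 0).IsInvariant (ZMod (q n))ˣ := by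
  obtain ⟨c₁, hc₁⟩ := primeAbovePow_le_logb_pow 606
  obtain ⟨c₂, hc₂⟩ := RamProg.primeProg_computesWithin (C := 606) (by norm_num)
  obtain ⟨c, h1c, h2c, h3c⟩ : ∃ c, c₁ ≤ c ∧ c₂ ≤ c ∧ 10 ^ 6 ≤ c :=
    ⟨c₁ + c₂ + 10 ^ 6, by omega, by omega, by omega⟩
  refine ⟨RamProg.primeProg 606, RamProg.orderProg, RamProg.neighborProg, c,
    RamProg.primeAbovePow 606, fun n hn => ?_, fun δ hδ hδ1 => ?_⟩
  · have hq := RamProg.primeAbovePow_prime 606 n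
    refine ⟨hq, (Nat.le_self_pow (by norm_num) n).trans_lt (RamProg.lt_primeAbovePow 606 n),
      (hc₁ n hn).trans ?_, ?_⟩
    · have hlog : (1 : ℝ) ≤ Real.logb 2 ((RamProg.primeAbovePow 606 n : ℝ) ^ n) := by
        rw [Real.le_logb_iff_rpow_le (by norm_num) (pow_pos (by exact_mod_cast hq.pos) n),
          Real.rpow_one]
        have h2 : 2 ≤ RamProg.primeAbovePow 606 n ^ n :=
          hq.two_le.trans (Nat.le_self_pow (by omega) _)
        exact_mod_cast h2
      gcongr
    · obtain ⟨σ, t, hr, ht, ho⟩ := hc₂ n hn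
      exact ⟨σ, t, hr, ht.trans (mul_pow_self_mono hn h2c), ho⟩
  · refine ⟨jetOrder δ, fun n => 2 / n, tendsto_const_div_atTop_nhds_zero_nat 2, ?_⟩
    filter_upwards [eventually_ge_atTop (⌈400 / δ⌉₊ + 20000)] with n hn
    have hn20 : 20000 ≤ n := by omega
    have hδn : 400 ≤ δ * n := by
      have h1 : (400 : ℝ) / δ ≤ n :=
        (Nat.le_ceil _).trans (by exact_mod_cast (by omega : ⌈400 / δ⌉₊ ≤ n))
      rw [div_le_iff₀ hδ] at h1
      linarith
    have hnr : (20000 : ℝ) ≤ n := by exact_mod_cast hn20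
    have hprime := RamProg.primeAbovePow_prime 606 n
    have hlt := RamProg.lt_primeAbovePow 606 n
    set q := RamProg.primeAbovePow 606 n
    have : Fact q.Prime := ⟨hprime⟩
    have hnq : n < q := (Nat.le_self_pow (by norm_num) n).trans_lt hlt
    have hfloor : jetOrder δ n + 1 = ⌊1.01 * δ * n⌋₊ := by
      refine Nat.sub_add_cancel (Nat.le_floor ?_)
      push_cast
      linarith
    have hs' : (jetOrder δ n : ℝ) + 1 ≤ 1.01 * δ * n := by
      have := Nat.floor_le (by positivity : 0 ≤ 1.01 * δ * n)
      rw [← hfloor] at this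
      exact_mod_cast this
    have hs : 1.01 * δ * n < jetOrder δ n + 2 := by
      have := Nat.lt_floor_add_one (1.01 * δ * n)
      rw [← hfloor] at this
      push_cast at this
      linarith
    have hsn : jetOrder δ n + 1 < n := by
      have : (jetOrder δ n : ℝ) + 1 < n := by nlinarith
      exact_mod_cast this
    have hF : ∀ k < n, k ≠ 0 → (k : ZMod q) ≠ 0 := by
      intro k hk hk0 h
      rw [ZMod.natCast_eq_zero_iff] at h
      exact absurd (Nat.le_of_dvd (Nat.pos_of_ne_zero hk0) h) (by omega)
    have hFs : ∀ k ≤ jetOrder δ n, k ≠ 0 → (k : ZMod q) ≠ 0 := fun k hk => hF k (by omega)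
    obtain ⟨D, hexp, hDlow, hDup⟩ := ktHalf_isLosslessExpander hn20 hlt hδn hs hs' hsn
    refine ⟨q ^ n, D, rfl, by simp, hsn, hexp, hDlow, hDup,
      not_isBipartite_ktHalf hFs hsn (by exact_mod_cast hF 2 (by omega) (by norm_num)),
      ⟨RamProg.ktNeighbor (jetOrder δ n), RamProg.isNeighborFunction_ktNeighbor hFs,
        fun f y t => ?_⟩, fun a b hb hab => ?_, exists_scaling_action hFs⟩
    · obtain ⟨σ, t, hr, ht, ho⟩ := RamProg.neighborProg_computesWithin hsn f y t
      refine ⟨σ, t, hr, ht.trans (Nat.mul_le_mul h3c (Nat.pow_le_pow_right (by omega) ?_)), ho⟩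
      exact (by norm_num : 6 ≤ 10 ^ 6).trans h3c
    · obtain ⟨σ, t, hr, ht, ho⟩ := RamProg.orderProg_computesWithin (by omega : 1 ≤ n) a b
      rw [hab, jetOrder_div]
      refine ⟨σ, t, hr, ht.trans (Nat.mul_le_mul ?_ (Nat.le_self_pow (by omega) _)), ho⟩
      exact (by norm_num : 420 ≤ 10 ^ 6).trans h3c
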